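/- Let $\Sigma$ be a smooth oriented three-manifold. Families of tensors $\{\cdot_t\}_{t\in\mathbb{R}}$ on $\Sigma$ are smooth, i.e. smooth sections over $\mathbb{R}\times\Sigma$ of the pull-back of the corresponding tensor bundle of $\Sigma$. For a family of Riemannian metrics $h_t$ and a family of nowhere vanishing functions $\lambda_t$ on $\Sigma$ put $\Theta_t=-\frac{1}{2\lambda_t}\partial_t h_t$ and, for a one-form $\alpha$, $\Theta_t(\alpha)=\Theta_t(\alpha^{\sharp_{h_t}},\cdot)$ and $\mathrm{d}\lambda_t(\alpha)=\mathrm{d}\lambda_t(\alpha^{\sharp_{h_t}})$. A \emph{parallel spinor flow} on $\mathbb{R}\times\Sigma$ is a tuple of families $(\lambda_t,h_t,u^0_t,u^\perp_t,l^\perp_t)$ of nowhere vanishing functions $\lambda_t$, Riemannian metrics $h_t$, nowhere vanishing functions $u^0_t$ and one-forms $u^\perp_t$, $l^\perp_t$ on $\Sigma$ with $$\partial_t u^\perp_t+\lambda_t\Theta_t(u^\perp_t)=u^0_t\,\mathrm{d}\lambda_t,\qquad u^0_t\partial_t l^\perp_t+\lambda_t u^0_t\Theta_t(l^\perp_t)+\mathrm{d}\lambda_t(l^\perp_t)\,u^\perp_t=0,$$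 $$\nabla^{h_t}u^\perp_t+u^0_t\Theta_t=0,\qquad u^0_t\nabla^{h_t}l^\perp_t=\Theta_t(l^\perp_t)\otimes u^\perp_t,$$ $$(u^0_t)^2=|u^\perp_t|^2_{h_t},\qquad |l^\perp_t|^2_{h_t}=1,\qquad h_t(u^\perp_t,l^\perp_t)=0.$$ It is \emph{comoving} if $\lambda_t=1$ for all $t$. We say that $(\mathbb{R}\times\Sigma,g)$ admits a comoving parallel spinor flow if there is one with $g=-\mathrm{d}t\otimes\mathrm{d}t+h_t$. For a family of coframes $\mathfrak{e}^t=(e^t_u,e^t_l,e^t_n)$ write $h_{\mathfrak{e}^t}=e^t_u\otimes e^t_u+e^t_l\otimes e^t_l+e^t_n\otimes e^t_n$ and now $\Theta_t=-\frac12\partial_t h_{\mathfrak{e}^t}$, with metric duals taken in $h_{\mathfrak{e}^t}$, and consider the system $$\partial_t\mathfrak{e}^t+\Theta_t(\mathfrak{e}^t)=0,\quad \mathrm{d}\mathfrak{e}^t=\Theta_t(\mathfrak{e}^t)\wedge e^t_u,\quad [\Theta_t(e^t_u)]=0\in H^1(\Sigma,\mathbb{R}),\quad \partial_t\big(\Theta_t(e^t_u)\big)=0,\qquad(\ast)$$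 for all $t\in\mathbb{R}$, where the first two equations hold for each of $e^t_u,e^t_l,e^t_n$. \textbf{Theorem.} For every field $g$ of bilinear forms on the tangent spaces of $\mathbb{R}\times\Sigma$, $(\mathbb{R}\times\Sigma,g)$ admits a comoving parallel spinor flow if and only if $\Sigma$ admits a family $\{\mathfrak{e}^t\}_{t\in\mathbb{R}}$ of oriented coframes satisfying $(\ast)$ with $$g=-\mathrm{d}t\otimes\mathrm{d}t+h_{\mathfrak{e}^t}.$$ Moreover $(\mathbb{R}\times\Sigma,g)$ admits a comoving parallel spinor flow and $g$ is comoving globally hyperbolic (that is, $g=-\mathrm{d}t\otimes\mathrm{d}t+h_t$ for a family of complete Riemannian metrics $h_t$) if and only if there is such a family $\{\mathfrak{e}^t\}$ for which all $h_{\mathfrak{e}^t}$ are complete. More precisely, for every comoving parallel spinor flow there is a unique family of oriented coframes $\mathfrak{e}^t$ with $h_{\mathfrak{e}^t}=h_t$, $u^0_te^t_u=u^\perp_t$ and $e^t_l=l^\perp_t$, and it satisfies $(\ast)$; and every family of oriented coframes satisfying $(\ast)$ arises in this way from a comoving parallel spinor flow. -/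

import Mathlib

open Bundle Filter Topology Manifold
open scoped ContDiff ENNReal

noncomputable section

namespace ComovingSpinor

/-- The model space of three-manifolds. -/
abbrev E3 : Type := EuclideanSpace ℝ (Fin 3)

section Fields

variable (S : Type*) [TopologicalSpace S] [ChartedSpace E3 S]

/-- Fields of covectors on `S` (no smoothness). -/
abbrev OneFormField : Type _ := ∀ x : S, TangentSpace (𝓡 3) x →L[ℝ] ℝ

/-- Fields of bilinear forms on the tangent spaces of `S` (no smoothness). -/
abbrev BilinField : Type _ :=
  ∀ x : S, TangentSpace (𝓡 3) x →L[ℝ] TangentSpace (𝓡 3) x →L[ℝ] ℝ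

variable [IsManifold (𝓡 3) ∞ S]

/-- An orientation of `S`: an orientation of every tangent space which, read in the trivialization
of the tangent bundle given by the preferred chart at `x₀`, is constant near `x₀`. -/
structure ManifoldOrientation where
  at' : ∀ x : S, Orientation ℝ (TangentSpace (𝓡 3) x) (Fin 3)
  locally_constant : ∀ x₀ : S, ∀ᶠ y in 𝓝 x₀,
    ∀ hy : y ∈ (trivializationAt E3 (TangentSpace (𝓡 3)) x₀).baseSet,
      Orientation.map (Fin 3)
        ((trivializationAt E3 (TangentSpace (𝓡 3)) x₀).continuousLinearEquivAt ℝ y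
          hy).toLinearEquiv (at' y) =
      Orientation.map (Fin 3)
        ((trivializationAt E3 (TangentSpace (𝓡 3)) x₀).continuousLinearEquivAt ℝ x₀
          (mem_baseSet_trivializationAt E3 (TangentSpace (𝓡 3)) x₀)).toLinearEquiv (at' x₀)

end Fields

section Tensors

variable {S : Type*} [TopologicalSpace S] [ChartedSpace E3 S]

/-- A smooth family of functions, that is, a smooth function on `ℝ × S`. -/
def SmoothFunctionFamily (f : ℝ → S → ℝ) : Prop :=
  ContMDiff (𝓘(ℝ, ℝ).prod (𝓡 3)) 𝓘(ℝ, ℝ) ∞ (fun p : ℝ × S => f p.1 p.2)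

/-- A smooth family of one-forms: a smooth section over `ℝ × S` of the pull-back of `T*S`. -/
def SmoothOneFormFamily [IsManifold (𝓡 3) ∞ S] (α : ℝ → OneFormField S) : Prop :=
  ContMDiff (𝓘(ℝ, ℝ).prod (𝓡 3)) ((𝓡 3).prod 𝓘(ℝ, E3 →L[ℝ] ℝ)) ∞
    (fun p : ℝ × S => TotalSpace.mk' (E3 →L[ℝ] ℝ)
      (E := fun x : S => TangentSpace (𝓡 3) x →L[ℝ] Bundle.Trivial S ℝ x) p.2 (α p.1 p.2))

/-- A smooth family of bilinear forms: a smooth section over `ℝ × S` of the pull-back of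
`T*S ⊗ T*S`. -/
def SmoothBilinFamily [IsManifold (𝓡 3) ∞ S] (h : ℝ → BilinField S) : Prop :=
  ContMDiff (𝓘(ℝ, ℝ).prod (𝓡 3)) ((𝓡 3).prod 𝓘(ℝ, E3 →L[ℝ] E3 →L[ℝ] ℝ)) ∞
    (fun p : ℝ × S => TotalSpace.mk' (E3 →L[ℝ] E3 →L[ℝ] ℝ)
      (E := fun x : S =>
        TangentSpace (𝓡 3) x →L[ℝ] TangentSpace (𝓡 3) x →L[ℝ] Bundle.Trivial S ℝ x)
      p.2 (h p.1 p.2))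

/-- Symmetric and positive definite at every point. -/
structure IsRiemannian (h : BilinField S) : Prop where
  symm : ∀ x v w, h x v w = h x w v
  pos : ∀ x v, v ≠ 0 → 0 < h x v v

open Classical in
/-- The metric dual `α♯` of the covector `α`: the vector with `h (α♯) w = α w` for all `w`.
It exists and is unique for a positive definite `h` on a finite-dimensional space; the default
value is never used for such `h`. -/
def sharp {V : Type*} [AddCommGroup V] [Module ℝ V] [TopologicalSpace V]
    [IsTopologicalAddGroup V] [ContinuousConstSMul ℝ V]
    (h : V →L[ℝ] V →L[ℝ] ℝ) (α : V →L[ℝ] ℝ) : V :=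
  if H : ∃ a : V, ∀ w : V, h a w = α w then H.choose else 0

/-- The inner product `h(α, β)` of two one-forms at `x`. -/
def formInner (h : BilinField S) (α β : OneFormField S) (x : S) : ℝ :=
  α x (sharp (h x) (β x))

/-! ### Differential operators, computed in the preferred chart at the point -/

/-- The components of a tangent vector at `x` in the preferred chart `φ` at `x`. -/
def coordVec (x : S) (v : TangentSpace (𝓡 3) x) : E3 :=
  mfderiv (𝓡 3) 𝓘(ℝ, E3) (extChartAt (𝓡 3) x) x v

/-- `(φ⁻¹)^* α`, where `φ` is the preferred chart at `x`. -/
def formInChart (α : OneFormField S) (x : S) (z : E3) (a : E3) : ℝ :=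
  α ((extChartAt (𝓡 3) x).symm z)
    (mfderiv 𝓘(ℝ, E3) (𝓡 3) (extChartAt (𝓡 3) x).symm z a)

/-- `(φ⁻¹)^* h`, where `φ` is the preferred chart at `x`. -/
def bilinInChart (h : BilinField S) (x : S) (z : E3) (a b : E3) : ℝ :=
  h ((extChartAt (𝓡 3) x).symm z)
    (mfderiv 𝓘(ℝ, E3) (𝓡 3) (extChartAt (𝓡 3) x).symm z a)
    (mfderiv 𝓘(ℝ, E3) (𝓡 3) (extChartAt (𝓡 3) x).symm z b)

/-- The exterior derivative of a one-form: `(dα)_{ij} = ∂_i α_j - ∂_j α_i`. -/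
def extDerivOneForm (α : OneFormField S) (x : S) (v w : TangentSpace (𝓡 3) x) : ℝ :=
  fderiv ℝ (fun z => formInChart α x z (coordVec x w)) (extChartAt (𝓡 3) x x) (coordVec x v) -
  fderiv ℝ (fun z => formInChart α x z (coordVec x v)) (extChartAt (𝓡 3) x x) (coordVec x w)

/-- The Christoffel symbols of the first kind of the metric `h` in the preferred chart at `x`:
`Γ_{kij} = ½ (∂_i h_{jk} + ∂_j h_{ik} - ∂_k h_{ij})`, contracted with the vectors `c, a, b`. -/
def christoffel (h : BilinField S) (x : S) (c a b : E3) : ℝ :=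
  (1 / 2) *
    (fderiv ℝ (fun z => bilinInChart h x z b c) (extChartAt (𝓡 3) x x) a +
     fderiv ℝ (fun z => bilinInChart h x z a c) (extChartAt (𝓡 3) x x) b -
     fderiv ℝ (fun z => bilinInChart h x z a b) (extChartAt (𝓡 3) x x) c)

/-- The Levi-Civita covariant derivative of a one-form, `(∇ʰα)(v, w) = (∇ʰ_v α)(w)`:
`∇_i α_j = ∂_i α_j - Γ^k_{ij} α_k = ∂_i α_j - Γ_{kij} (α♯)^k`. -/
def covDeriv (h : BilinField S) (α : OneFormField S) (x : S)
    (v w : TangentSpace (𝓡 3) x) : ℝ :=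
  fderiv ℝ (fun z => formInChart α x z (coordVec x w)) (extChartAt (𝓡 3) x x) (coordVec x v) -
  christoffel h x (coordVec x (sharp (h x) (α x))) (coordVec x v) (coordVec x w)

/-! ### The second fundamental form -/

/-- `Θ_t = - (1 / (2 λ_t)) ∂_t h_t`. -/
def shape (lapse : ℝ → S → ℝ) (h : ℝ → BilinField S) (t : ℝ) (x : S)
    (v w : TangentSpace (𝓡 3) x) : ℝ :=
  -(1 / (2 * lapse t x)) * deriv (fun s => h s x v w) t

/-- The one-form `Θ_t(α) = Θ_t(α♯, ·)`, with `♯` taken with respect to `h_t`. -/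
def shapeForm (lapse : ℝ → S → ℝ) (h : ℝ → BilinField S) (t : ℝ) (α : OneFormField S) (x : S)
    (w : TangentSpace (𝓡 3) x) : ℝ :=
  shape lapse h t x (sharp (h t x) (α x)) w

/-! ### Metrics on `ℝ × S` -/

/-- Fields of bilinear forms on the tangent spaces of the four-manifold `ℝ × S`. -/
abbrev SpacetimeBilinField (S : Type*) [TopologicalSpace S] [ChartedSpace E3 S] : Type _ :=
  ∀ p : ℝ × S, TangentSpace (𝓘(ℝ, ℝ).prod (𝓡 3)) p →L[ℝ]
    TangentSpace (𝓘(ℝ, ℝ).prod (𝓡 3)) p →L[ℝ] ℝ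

/-- `g = - λ_t² dt ⊗ dt + h_t` on `ℝ × S`. -/
def IsStandardMetric (g : SpacetimeBilinField S) (lapse : ℝ → S → ℝ) (h : ℝ → BilinField S) :
    Prop :=
  ∀ (p : ℝ × S) (V W : TangentSpace (𝓘(ℝ, ℝ).prod (𝓡 3)) p),
    g p V W =
      -(lapse p.1 p.2) ^ 2 *
        (mvfderiv (𝓘(ℝ, ℝ).prod (𝓡 3)) (Prod.fst : ℝ × S → ℝ) p V *
          mvfderiv (𝓘(ℝ, ℝ).prod (𝓡 3)) (Prod.fst : ℝ × S → ℝ) p W) +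
      h p.1 p.2 (mfderiv (𝓘(ℝ, ℝ).prod (𝓡 3)) (𝓡 3) (Prod.snd : ℝ × S → S) p V)
        (mfderiv (𝓘(ℝ, ℝ).prod (𝓡 3)) (𝓡 3) (Prod.snd : ℝ × S → S) p W)

/-- The Riemannian distance of `h`: the infimum of the `h`-lengths of `C^1` paths. -/
def riemDist (h : BilinField S) (x y : S) : ℝ≥0∞ :=
  letI : ∀ z : S, ENorm (TangentSpace (𝓡 3) z) :=
    fun z => ⟨fun v => ENNReal.ofReal (Real.sqrt (h z v v))⟩
  riemannianEDist (𝓡 3) x y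

/-- Completeness of a Riemannian metric: Cauchy sequences for its distance converge. -/
def IsCompleteMetric (h : BilinField S) : Prop :=
  ∀ a : ℕ → S, (∀ ε : ℝ≥0∞, 0 < ε → ∃ N, ∀ m ≥ N, ∀ n ≥ N, riemDist h (a m) (a n) < ε) →
    ∃ x, Tendsto a atTop (𝓝 x)

end Tensors

section Flows

variable {S : Type*} [TopologicalSpace S] [ChartedSpace E3 S] [IsManifold (𝓡 3) ∞ S]

/-- `g = - dt ⊗ dt + h_t` on `ℝ × S` for a smooth family of complete Riemannian metrics `h_t`. -/
def IsComovingGloballyHyperbolic (g : SpacetimeBilinField S) : Prop :=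
  ∃ h : ℝ → BilinField S, SmoothBilinFamily h ∧ (∀ t, IsRiemannian (h t)) ∧
    (∀ t, IsCompleteMetric (h t)) ∧ IsStandardMetric g (fun _ _ => 1) h

variable (S) in
/-- A parallel spinor flow on `ℝ × S`: smooth families `λ_t`, `h_t`, `u⁰_t`, `u^⊥_t`, `l^⊥_t` such
that `u = u⁰_t λ_t dt + u^⊥_t` is a nowhere vanishing null one-form (equivalently `u⁰` has no zero
and `(u⁰)² = |u^⊥|²`), `l^⊥` is a unit one-form orthogonal to `u^⊥`, and the evolution and
constraint equations hold. -/
structure ParallelSpinorFlow where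
  lapse : ℝ → S → ℝ
  h : ℝ → BilinField S
  u0 : ℝ → S → ℝ
  u : ℝ → OneFormField S
  l : ℝ → OneFormField S
  smooth_lapse : SmoothFunctionFamily lapse
  smooth_h : SmoothBilinFamily h
  smooth_u0 : SmoothFunctionFamily u0
  smooth_u : SmoothOneFormFamily u
  smooth_l : SmoothOneFormFamily l
  lapse_ne_zero : ∀ t x, lapse t x ≠ 0
  riemannian : ∀ t, IsRiemannian (h t)
  u0_ne_zero : ∀ t x, u0 t x ≠ 0
  /-- `∂_t u^⊥ + λ Θ(u^⊥) = u⁰ dλ`. -/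
  evolution_u : ∀ t x (v : TangentSpace (𝓡 3) x),
    deriv (fun s => u s x v) t + lapse t x * shapeForm lapse h t (u t) x v =
      u0 t x * mvfderiv (𝓡 3) (lapse t) x v
  /-- `u⁰ ∂_t l^⊥ + λ u⁰ Θ(l^⊥) + dλ(l^⊥) u^⊥ = 0`. -/
  evolution_l : ∀ t x (v : TangentSpace (𝓡 3) x),
    u0 t x * deriv (fun s => l s x v) t +
      lapse t x * u0 t x * shapeForm lapse h t (l t) x v +
      mvfderiv (𝓡 3) (lapse t) x (sharp (h t x) (l t x)) * u t x v = 0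
  /-- `∇ u^⊥ + u⁰ Θ = 0`. -/
  constraint_u : ∀ t x (v w : TangentSpace (𝓡 3) x),
    covDeriv (h t) (u t) x v w + u0 t x * shape lapse h t x v w = 0
  /-- `u⁰ ∇ l^⊥ = Θ(l^⊥) ⊗ u^⊥`. -/
  constraint_l : ∀ t x (v w : TangentSpace (𝓡 3) x),
    u0 t x * covDeriv (h t) (l t) x v w = shapeForm lapse h t (l t) x v * u t x w
  norm_u : ∀ t x, (u0 t x) ^ 2 = formInner (h t) (u t) (u t) x
  norm_l : ∀ t x, formInner (h t) (l t) (l t) x = 1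
  orthogonal : ∀ t x, formInner (h t) (u t) (l t) x = 0

/-- The flow is comoving if `λ_t = 1` for all `t`. -/
def ParallelSpinorFlow.IsComoving (F : ParallelSpinorFlow S) : Prop :=
  ∀ t x, F.lapse t x = 1

/-- `(ℝ × S, g)` admits a comoving parallel spinor flow: there is one whose space-time metric
`- λ_t² dt ⊗ dt + h_t` is `g`. -/
def AdmitsComovingParallelSpinorFlow (g : SpacetimeBilinField S) : Prop :=
  ∃ F : ParallelSpinorFlow S, F.IsComoving ∧ IsStandardMetric g F.lapse F.h

/-- A smooth family of oriented coframes `e^t = (e_u, e_l, e_n) = (e 0, e 1, e 2)` on `S`, that is,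
of sections of the bundle of oriented coframes: `e_u ∧ e_l ∧ e_n` is positive on the positively
oriented bases of the tangent spaces. -/
structure IsOrientedCoframeFamily (o : ManifoldOrientation S)
    (e : Fin 3 → ℝ → OneFormField S) : Prop where
  smooth : ∀ i, SmoothOneFormFamily (e i)
  oriented : ∀ t x (b : Module.Basis (Fin 3) ℝ (TangentSpace (𝓡 3) x)),
    b.orientation = o.at' x → 0 < (Matrix.of fun i j => e i t x (b j)).det

/-- `h_{e^t} = e_u ⊗ e_u + e_l ⊗ e_l + e_n ⊗ e_n`. -/
def coframeMetric (e : Fin 3 → ℝ → OneFormField S) (t : ℝ) : BilinField S :=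
  fun x => ∑ i, (e i t x).smulRight (e i t x)

/-- `Θ_t(α)` for `Θ_t = - ½ ∂_t h_{e^t}`. -/
def coframeShapeForm (e : Fin 3 → ℝ → OneFormField S) (t : ℝ) (α : OneFormField S) (x : S)
    (w : TangentSpace (𝓡 3) x) : ℝ :=
  shapeForm (fun _ _ => 1) (coframeMetric e) t α x w

/-- The comoving parallel spinor flow equations for a family of coframes. -/
structure ComovingFlowEquations (e : Fin 3 → ℝ → OneFormField S) : Prop where
  /-- `∂_t e^t + Θ_t(e^t) = 0`. -/
  evolution : ∀ i t x (v : TangentSpace (𝓡 3) x),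
    deriv (fun s => e i s x v) t + coframeShapeForm e t (e i t) x v = 0
  /-- `d e^t = Θ_t(e^t) ∧ e_u^t`. -/
  structure_eq : ∀ i t x (v w : TangentSpace (𝓡 3) x),
    extDerivOneForm (e i t) x v w =
      coframeShapeForm e t (e i t) x v * e 0 t x w - coframeShapeForm e t (e i t) x w * e 0 t x v
  /-- `[Θ_t(e_u^t)] = 0` in de Rham cohomology, that is, `Θ_t(e_u^t)` is exact. -/
  exact : ∀ t, ∃ f : S → ℝ, ContMDiff (𝓡 3) 𝓘(ℝ, ℝ) ∞ f ∧
    ∀ x (v : TangentSpace (𝓡 3) x), mvfderiv (𝓡 3) f x v = coframeShapeForm e t (e 0 t) x v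
  /-- `∂_t (Θ_t(e_u^t)) = 0`. -/
  stationary : ∀ t x (v : TangentSpace (𝓡 3) x),
    deriv (fun s => coframeShapeForm e s (e 0 s) x v) t = 0

/-- The coframes `e^t` are orthonormal for `h_t`, with `u^⊥ = u⁰ e_u` and `l^⊥ = e_l`. -/
structure IsAdapted (F : ParallelSpinorFlow S) (e : Fin 3 → ℝ → OneFormField S) : Prop where
  metric : ∀ t, F.h t = coframeMetric e t
  u_eq : ∀ t x, F.u t x = F.u0 t x • e 0 t x
  l_eq : ∀ t x, F.l t x = e 1 t x

end Flows

end ComovingSpinor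

end

/-! Write `e_u = u^⊥/u⁰`, `e_l = l^⊥`, and let `e_n` be the third covector of the oriented
orthonormal coframe. Everything rests on differentiating `h = ∑ eᵢ ⊗ eᵢ`. In time this says that the
defects `Aᵢ = ∂_t eᵢ + Θ(eᵢ)` form a skew matrix in the frame (`evolution_metric`); in space, that
the `∇_v eᵢ` do (`covDeriv_metric`).

From flow to coframe: the equation for `u^⊥` reads `(∂_t u⁰) e_u + u⁰ A_u = 0`. Skewness removes the
`e_u`-component of `A_u`, so `∂_t u⁰ = 0` and `A_u = 0`; the equation for `l^⊥` gives `A_l = 0`, and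
skewness then gives `A_n = 0`. In the same way the constraints split into `du⁰ = -u⁰ Θ(e_u)`, `∇e_u
= Θ(e_u) ⊗ e_u - Θ` and `∇eᵢ = Θ(eᵢ) ⊗ e_u` for `i = l, n`. Antisymmetrising removes the symmetric
`Θ` and leaves the structure equations, while `Θ(e_u) = -d log|u⁰|` is exact and stationary.

From coframe to flow: the structure equations and metric compatibility determine `∇eᵢ`, because a
tensor symmetric in two slots and skew in an overlapping pair vanishes (`eq_zero_of_symm_of_skew`).
If `df = Θ(e_u)` at `t = 0`, stationarity extends this to all times, and `u⁰ = exp(-f)` gives the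
flow.

The remaining work is the existence, smoothness and uniqueness of `e_n` (`exists_adapted`,
`IsAdapted.unique`), where the orientation fixes its sign. -/

noncomputable section

namespace ComovingSpinor

/-! ### Slices of smooth families of functions. -/

section FunctionFamilies

variable {S : Type*} [TopologicalSpace S] [ChartedSpace E3 S]

theorem SmoothFunctionFamily.contMDiff {f : ℝ → S → ℝ} (hf : SmoothFunctionFamily f) (t : ℝ) :
    ContMDiff (𝓡 3) 𝓘(ℝ, ℝ) ∞ (f t) :=
  ContMDiff.comp (g := fun p : ℝ × S => f p.1 p.2) hf (contMDiff_const.prodMk contMDiff_id)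

theorem SmoothFunctionFamily.differentiable {f : ℝ → S → ℝ} (hf : SmoothFunctionFamily f) (x : S) :
    Differentiable ℝ (fun t => f t x) := by
  have h : ContMDiff 𝓘(ℝ, ℝ) 𝓘(ℝ, ℝ) ∞ (fun t => f t x) :=
    ContMDiff.comp (g := fun p : ℝ × S => f p.1 p.2) hf (contMDiff_id.prodMk contMDiff_const)
  exact h.contDiff.differentiable (by simp)

end FunctionFamilies

/-! ### Smoothness and derivatives in chart frames. -/

section LocalFrames

variable {S : Type*} [TopologicalSpace S] [ChartedSpace E3 S] [IsManifold (𝓡 3) ∞ S]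

/-- The tangent vector at `y` whose components in the preferred chart at `x₀` are `a`. -/
def frameVec (x₀ y : S) : E3 →L[ℝ] TangentSpace (𝓡 3) y :=
  (trivializationAt E3 (TangentSpace (𝓡 3)) x₀).symmL ℝ y

/-- On a finite-dimensional source, `f q` is a fixed continuous linear expression in its values on a
basis. -/
theorem contMDiffAt_clm_of_apply {M : Type*} [TopologicalSpace M] [ChartedSpace (ModelProd ℝ E3) M]
    {F : Type*} [NormedAddCommGroup F] [NormedSpace ℝ F] {f : M → E3 →L[ℝ] F} {p : M}
    (hf : ∀ a, ContMDiffAt (𝓘(ℝ, ℝ).prod (𝓡 3)) 𝓘(ℝ, F) ∞ (fun q => f q a) p) :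
    ContMDiffAt (𝓘(ℝ, ℝ).prod (𝓡 3)) 𝓘(ℝ, E3 →L[ℝ] F) ∞ f p := by
  have key : f = fun q => ∑ i : Fin 3,
      ContinuousLinearMap.smulRightL ℝ E3 F (EuclideanSpace.proj i)
        (f q (EuclideanSpace.basisFun (Fin 3) ℝ i)) := by
    funext q
    ext v
    conv_lhs => rw [← (EuclideanSpace.basisFun (Fin 3) ℝ).sum_repr v]
    simp [map_sum]
  rw [key]
  refine ContMDiffAt.sum fun i _ => ?_
  exact (ContinuousLinearMap.smulRightL ℝ E3 F
    (EuclideanSpace.proj i)).contMDiff.contMDiffAt.comp p (hf _)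

/-- This reduces smoothness of sections to smoothness of real-valued components, so that sums,
products and quotients can be treated as functions. -/
theorem smoothOneFormFamily_iff {α : ℝ → OneFormField S} :
    SmoothOneFormFamily α ↔ ∀ (p₀ : ℝ × S) (a : E3),
      ContMDiffAt (𝓘(ℝ, ℝ).prod (𝓡 3)) 𝓘(ℝ, ℝ) ∞
        (fun p : ℝ × S => α p.1 p.2 (frameVec p₀.2 p.2 a)) p₀ := by
  unfold SmoothOneFormFamily ContMDiff
  refine forall_congr' fun p₀ => ?_
  rw [contMDiffAt_hom_bundle]
  have h1 : ∀ (p : ℝ × S) (a : E3), ContinuousLinearMap.inCoordinates E3 (TangentSpace (𝓡 3)) ℝ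
      (Bundle.Trivial S ℝ) p₀.2 p.2 p₀.2 p.2 (α p.1 p.2) a =
      α p.1 p.2 (frameVec p₀.2 p.2 a) := by
    intro p a
    simp [ContinuousLinearMap.inCoordinates, frameVec]
  constructor
  · rintro ⟨-, h⟩ a
    have := (ContinuousLinearMap.apply ℝ ℝ a).contMDiff.contMDiffAt.comp p₀ h
    refine this.congr_of_eventuallyEq (.of_forall fun p => ?_)
    exact (h1 p a).symm
  · intro h
    refine ⟨contMDiffAt_snd, contMDiffAt_clm_of_apply fun a => ?_⟩
    refine (h a).congr_of_eventuallyEq (.of_forall fun p => ?_)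
    exact h1 p a

theorem smoothBilinFamily_iff {h : ℝ → BilinField S} :
    SmoothBilinFamily h ↔ ∀ (p₀ : ℝ × S) (a b : E3),
      ContMDiffAt (𝓘(ℝ, ℝ).prod (𝓡 3)) 𝓘(ℝ, ℝ) ∞
        (fun p : ℝ × S => h p.1 p.2 (frameVec p₀.2 p.2 a) (frameVec p₀.2 p.2 b)) p₀ := by
  unfold SmoothBilinFamily ContMDiff
  refine forall_congr' fun p₀ => ?_
  rw [contMDiffAt_hom_bundle]
  have h1 : ∀ᶠ p : ℝ × S in 𝓝 p₀, ∀ (a b : E3),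
      ContinuousLinearMap.inCoordinates E3 (TangentSpace (𝓡 3)) (E3 →L[ℝ] ℝ)
      (fun x : S => TangentSpace (𝓡 3) x →L[ℝ] Bundle.Trivial S ℝ x)
        p₀.2 p.2 p₀.2 p.2 (h p.1 p.2) a b =
      h p.1 p.2 (frameVec p₀.2 p.2 a) (frameVec p₀.2 p.2 b) := by
    have : (trivializationAt E3 (TangentSpace (𝓡 3)) p₀.2).baseSet ∈ 𝓝 p₀.2 :=
      (trivializationAt E3 (TangentSpace (𝓡 3)) p₀.2).open_baseSet.mem_nhds
        (mem_baseSet_trivializationAt E3 (TangentSpace (𝓡 3)) p₀.2)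
    filter_upwards [continuous_snd.continuousAt.preimage_mem_nhds this] with p hp a b
    rw [inCoordinates_apply_eq₂ hp hp (Set.mem_univ _)]
    have hp' : p.2 ∈ (trivializationAt E3 (TangentSpace (𝓡 3)) p₀.2).baseSet := hp
    simp [frameVec, Trivialization.symmL_apply _ hp']
  constructor
  · rintro ⟨-, hs⟩ a b
    have := (hs.clm_apply (contMDiffAt_const (c := a))).clm_apply (contMDiffAt_const (c := b))
    refine this.congr_of_eventuallyEq (h1.mono fun p hp => ?_)
    exact (hp a b).symm
  · intro hs
    refine ⟨contMDiffAt_snd, contMDiffAt_clm_of_apply fun a => contMDiffAt_clm_of_apply fun b => ?_⟩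
    refine (hs a b).congr_of_eventuallyEq (h1.mono fun p hp => ?_)
    exact hp a b

theorem frameVec_eq_mfderiv {x₀ y : S} (hy : y ∈ (chartAt E3 x₀).source) (a : E3) :
    frameVec x₀ y a =
      mfderiv 𝓘(ℝ, E3) (𝓡 3) (extChartAt (𝓡 3) x₀).symm (extChartAt (𝓡 3) x₀ y) a := by
  unfold frameVec
  rw [TangentBundle.symmL_trivializationAt hy]
  rw [ModelWithCorners.range_eq_univ, mfderivWithin_univ]
  rfl

theorem frameVec_coordVec (x : S) (v : TangentSpace (𝓡 3) x) :
    frameVec x x (coordVec x v) = v := by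
  unfold frameVec coordVec
  have hx := mem_baseSet_trivializationAt E3 (TangentSpace (𝓡 3)) x
  rw [← TangentBundle.continuousLinearMapAt_trivializationAt (mem_chart_source E3 x)]
  exact Trivialization.symmL_continuousLinearMapAt _ hx v

/-- The bridge between the chart pull-backs, in which the differential operators are defined, and
the bundle frames, in which smoothness is expressed. -/
theorem formInChart_eq_frameVec (α : OneFormField S) {x : S} {z : E3}
    (hz : z ∈ (extChartAt (𝓡 3) x).target) (a : E3) :
    formInChart α x z a = α ((extChartAt (𝓡 3) x).symm z)
      (frameVec x ((extChartAt (𝓡 3) x).symm z) a) := by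
  have hy : (extChartAt (𝓡 3) x).symm z ∈ (chartAt E3 x).source := by
    simpa only [extChartAt_source] using (extChartAt (𝓡 3) x).map_target hz
  rw [frameVec_eq_mfderiv hy, (extChartAt (𝓡 3) x).right_inv hz]
  rfl

theorem formInChart_coordVec (α : OneFormField S) (x : S) (w : TangentSpace (𝓡 3) x) :
    formInChart α x (extChartAt (𝓡 3) x x) (coordVec x w) = α x w := by
  rw [formInChart_eq_frameVec α (mem_extChartAt_target x), extChartAt_to_inv, frameVec_coordVec]

theorem contMDiffAt_chart_symm_pair (t : ℝ) (x : S) :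
    ContMDiffAt 𝓘(ℝ, E3) (𝓘(ℝ, ℝ).prod (𝓡 3)) ∞
      (fun z : E3 => ((t, (extChartAt (𝓡 3) x).symm z) : ℝ × S)) (extChartAt (𝓡 3) x x) :=
  contMDiffAt_const.prodMk
    ((contMDiffOn_extChartAt_symm x).contMDiffAt (extChartAt_target_mem_nhds x))

theorem SmoothOneFormFamily.differentiableAt_formInChart {α : ℝ → OneFormField S}
    (hα : SmoothOneFormFamily α) (t : ℝ) (x : S) (a : E3) :
    DifferentiableAt ℝ (fun z => formInChart (α t) x z a) (extChartAt (𝓡 3) x x) := by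
  have h1 := smoothOneFormFamily_iff.1 hα (t, x) a
  have h2 := ContMDiffAt.comp_of_eq h1 (contMDiffAt_chart_symm_pair t x) (by simp)
  refine ((h2.contDiffAt).differentiableAt (by simp)).congr_of_eventuallyEq ?_
  filter_upwards [extChartAt_target_mem_nhds (I := 𝓡 3) x] with z hz
  exact formInChart_eq_frameVec (α t) hz a

theorem SmoothOneFormFamily.contDiff_apply {α : ℝ → OneFormField S}
    (hα : SmoothOneFormFamily α) (x : S) (v : TangentSpace (𝓡 3) x) :
    ContDiff ℝ ∞ (fun s => α s x v) := by
  refine contDiff_iff_contDiffAt.2 fun t => ?_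
  have h1 := smoothOneFormFamily_iff.1 hα (t, x) (coordVec x v)
  have h2 : ContMDiffAt 𝓘(ℝ, ℝ) (𝓘(ℝ, ℝ).prod (𝓡 3)) ∞ (fun s : ℝ => ((s, x) : ℝ × S)) t :=
    contMDiffAt_id.prodMk contMDiffAt_const
  have h3 := ContMDiffAt.comp t h1 h2
  refine h3.contDiffAt.congr_of_eventuallyEq (.of_forall fun s => ?_)
  simp [frameVec_coordVec]

theorem SmoothOneFormFamily.differentiable_apply {α : ℝ → OneFormField S}
    (hα : SmoothOneFormFamily α) (x : S) (v : TangentSpace (𝓡 3) x) :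
    Differentiable ℝ (fun s => α s x v) :=
  (hα.contDiff_apply x v).differentiable (by simp)

theorem differentiableAt_comp_chart_symm {f : S → ℝ} {x : S}
    (hf : ContMDiffAt (𝓡 3) 𝓘(ℝ, ℝ) ∞ f x) :
    DifferentiableAt ℝ (fun z => f ((extChartAt (𝓡 3) x).symm z)) (extChartAt (𝓡 3) x x) := by
  have h2 := ContMDiffAt.comp_of_eq hf
    ((contMDiffOn_extChartAt_symm x).contMDiffAt (extChartAt_target_mem_nhds x)) (by simp)
  exact h2.contDiffAt.differentiableAt (by simp)

theorem mvfderiv_eq_fderiv_chart {f : S → ℝ} {x : S}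
    (hf : ContMDiffAt (𝓡 3) 𝓘(ℝ, ℝ) ∞ f x) (v : TangentSpace (𝓡 3) x) :
    mvfderiv (𝓡 3) f x v =
      fderiv ℝ (fun z => f ((extChartAt (𝓡 3) x).symm z)) (extChartAt (𝓡 3) x x)
        (coordVec x v) := by
  have h1 : f =ᶠ[𝓝 x] (fun z => f ((extChartAt (𝓡 3) x).symm z)) ∘ extChartAt (𝓡 3) x := by
    filter_upwards [extChartAt_source_mem_nhds (I := 𝓡 3) x] with y hy
    rw [Function.comp_apply, (extChartAt (𝓡 3) x).left_inv hy]
  have h2 : mfderiv (𝓡 3) 𝓘(ℝ, ℝ) f x =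
      (mfderiv 𝓘(ℝ, E3) 𝓘(ℝ, ℝ) (fun z => f ((extChartAt (𝓡 3) x).symm z))
        (extChartAt (𝓡 3) x x)).comp (mfderiv (𝓡 3) 𝓘(ℝ, E3) (extChartAt (𝓡 3) x) x) := by
    rw [h1.mfderiv_eq]
    exact mfderiv_comp x (differentiableAt_comp_chart_symm hf).mdifferentiableAt
      (mdifferentiableAt_extChartAt (mem_chart_source E3 x))
  rw [mfderiv_eq_fderiv] at h2
  exact congrArg (fun L => L v) h2

end LocalFrames

/-! ### Linear algebra of coframes and metric duals. -/

section Algebra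

/-- A tensor that is symmetric in two slots and skew in two others vanishes. -/
theorem eq_zero_of_symm_of_skew {V : Type*} {c : Fin 3 → V → ℝ} {E : Fin 3 → V}
    (hE : ∀ i j, c i (E j) = if i = j then 1 else 0) {D : Fin 3 → V → V → ℝ}
    (hsymm : ∀ i v w, D i v w = D i w v)
    (hskew : ∀ v w z, ∑ i, (D i v w * c i z + D i v z * c i w) = 0) (i : Fin 3) (v w : V) :
    D i v w = 0 := by
  have skew : ∀ v w z, ∑ i, D i v w * c i z = -∑ i, D i v z * c i w := fun v w z => by
    have := hskew v w z
    rw [Finset.sum_add_distrib] at this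
    linarith
  have symm : ∀ v w z, ∑ i, D i v w * c i z = ∑ i, D i w v * c i z := fun v w z =>
    Finset.sum_congr rfl fun i _ => by rw [hsymm]
  -- Pairing with `E i` extracts `D i v w`. Alternating the two symmetries three times each returns
  -- to the same term with the opposite sign.
  have zero : ∑ j, D j v w * c j (E i) = 0 := by
    have h1 := skew v w (E i)
    have h2 := symm v (E i) w
    have h3 := skew (E i) v w
    have h4 := symm (E i) w v
    have h5 := skew w (E i) v
    have h6 := symm w v (E i)
    linarith
  simpa [hE] using zero

variable {V : Type*} [AddCommGroup V] [Module ℝ V]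

/-- The map `v ↦ (cᵢ v)` onto `ℝ³` is surjective, hence injective by equality of dimensions, and
both sides have the same image. -/
theorem eq_sum_of_biorthogonal (hV : Module.finrank ℝ V = 3) {c : Fin 3 → V →ₗ[ℝ] ℝ} {E : Fin 3 → V}
    (hE : ∀ i j, c i (E j) = if i = j then 1 else 0) (v : V) : v = ∑ i, c i v • E i := by
  have : FiniteDimensional ℝ V := Module.finite_of_finrank_eq_succ hV
  have hsurj : Function.Surjective (LinearMap.pi c) := by
    intro r
    refine ⟨∑ j, r j • E j, ?_⟩
    ext i
    simp [hE]
  have hinj := (LinearMap.injective_iff_surjective_of_finrank_eq_finrank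
    (by simp [hV] : Module.finrank ℝ V = Module.finrank ℝ (Fin 3 → ℝ))).2 hsurj
  apply hinj
  ext i
  simp [hE]

theorem exists_biorthogonal {c : Fin 3 → V →ₗ[ℝ] ℝ} (b : Module.Basis (Fin 3) ℝ V)
    (hb : (Matrix.of fun i j => c i (b j)).det ≠ 0) :
    ∃ E : Fin 3 → V, ∀ i j, c i (E j) = if i = j then 1 else 0 := by
  have hdet : IsUnit (LinearMap.toMatrix b (Pi.basisFun ℝ (Fin 3)) (LinearMap.pi c)).det := by
    rw [isUnit_iff_ne_zero]
    convert hb using 2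
    ext i j
    simp [LinearMap.toMatrix_apply]
  let L := LinearEquiv.ofIsUnitDet hdet
  refine ⟨fun j => L.symm (Pi.single j 1), fun i j => ?_⟩
  have h : L (L.symm (Pi.single j 1)) i = (Pi.single j 1 : Fin 3 → ℝ) i := by simp
  have h' : L (L.symm (Pi.single j 1)) i = c i (L.symm (Pi.single j 1)) := rfl
  rw [← h', h, Pi.single_apply]

variable [TopologicalSpace V] [IsTopologicalAddGroup V] [ContinuousConstSMul ℝ V]

theorem sharp_eq {h : V →L[ℝ] V →L[ℝ] ℝ} (hh : ∀ v, v ≠ 0 → h v v ≠ 0) {α : V →L[ℝ] ℝ} {a : V}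
    (ha : ∀ w, h a w = α w) : sharp h α = a := by
  have H : ∃ a : V, ∀ w : V, h a w = α w := ⟨a, ha⟩
  rw [sharp, dif_pos H]
  by_contra hne
  have hdiff : ∀ w, h (H.choose - a) w = 0 := fun w => by
    rw [map_sub, sub_apply, H.choose_spec, ha, sub_self]
  exact hh _ (sub_ne_zero.2 hne) (hdiff _)

/-- `v ↦ h v` is injective because `h v v ≠ 0`, hence onto the dual by dimension. -/
theorem sharp_apply [FiniteDimensional ℝ V] {h : V →L[ℝ] V →L[ℝ] ℝ} (hh : ∀ v, v ≠ 0 → h v v ≠ 0)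
    (α : V →L[ℝ] ℝ) (w : V) : h (sharp h α) w = α w := by
  let L : V →ₗ[ℝ] Module.Dual ℝ V :=
    { toFun := fun v => (h v).toLinearMap
      map_add' := by intros; ext; simp
      map_smul' := by intros; ext; simp }
  have hinj : Function.Injective L := by
    refine (injective_iff_map_eq_zero L).2 fun v hv => ?_
    by_contra hne
    exact hh v hne (congrArg (fun f : Module.Dual ℝ V => f v) hv)
  have hsurj := (LinearMap.injective_iff_surjective_of_finrank_eq_finrank
    (Subspace.dual_finrank_eq (K := ℝ) (V := V)).symm).1 hinj
  obtain ⟨a, ha⟩ := hsurj α.toLinearMap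
  have ha' : ∀ w, h a w = α w := fun w => congrArg (fun f : Module.Dual ℝ V => f w) ha
  rw [sharp_eq hh ha', ha']

end Algebra

/-! ### The metric of an oriented coframe and its dual frame. -/

section Coframes

variable {S : Type*} [TopologicalSpace S] [ChartedSpace E3 S]

theorem finrank_tangentSpace (x : S) : Module.finrank ℝ (TangentSpace (𝓡 3) x) = 3 := by
  change Module.finrank ℝ E3 = 3
  simp

theorem IsRiemannian.self_ne_zero {h : BilinField S} (hh : IsRiemannian h) (x : S)
    (v : TangentSpace (𝓡 3) x) (hv : v ≠ 0) : h x v v ≠ 0 :=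
  (hh.pos x v hv).ne'

theorem coframeMetric_apply (e : Fin 3 → ℝ → OneFormField S) (t : ℝ) (x : S)
    (v w : TangentSpace (𝓡 3) x) :
    coframeMetric e t x v w = ∑ i, e i t x v * e i t x w := by
  simp [coframeMetric]

variable {e : Fin 3 → ℝ → OneFormField S}

theorem eq_sum_of_dual {t : ℝ} {x : S} {E : Fin 3 → TangentSpace (𝓡 3) x}
    (hE : ∀ i j, e i t x (E j) = if i = j then 1 else 0) (v : TangentSpace (𝓡 3) x) :
    v = ∑ i, e i t x v • E i :=
  eq_sum_of_biorthogonal (c := fun i => (e i t x).toLinearMap) (finrank_tangentSpace x) hE v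

variable [IsManifold (𝓡 3) ∞ S] {o : ManifoldOrientation S}

theorem exists_oriented_basis (o : ManifoldOrientation S) (x : S) :
    ∃ b : Module.Basis (Fin 3) ℝ (TangentSpace (𝓡 3) x), b.orientation = o.at' x := by
  have : Module.Finite ℝ (TangentSpace (𝓡 3) x) :=
    Module.finite_of_finrank_eq_succ (finrank_tangentSpace x)
  let b₀ : Module.Basis (Fin 3) ℝ (TangentSpace (𝓡 3) x) :=
    Module.finBasisOfFinrankEq ℝ _ (finrank_tangentSpace x)
  exact ⟨b₀.adjustToOrientation (o.at' x), b₀.orientation_adjustToOrientation _⟩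

/-- The frame dual to a coframe. -/
theorem IsOrientedCoframeFamily.exists_dual (he : IsOrientedCoframeFamily o e) (t : ℝ) (x : S) :
    ∃ E : Fin 3 → TangentSpace (𝓡 3) x, ∀ i j, e i t x (E j) = if i = j then 1 else 0 := by
  obtain ⟨b, hb⟩ := exists_oriented_basis o x
  exact exists_biorthogonal (c := fun i => (e i t x).toLinearMap) b (he.oriented t x b hb).ne'

theorem IsOrientedCoframeFamily.isRiemannian (he : IsOrientedCoframeFamily o e) (t : ℝ) :
    IsRiemannian (coframeMetric e t) where
  symm x v w := by
    simp only [coframeMetric_apply]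
    exact Finset.sum_congr rfl fun i _ => mul_comm _ _
  pos x v hv := by
    obtain ⟨E, hE⟩ := he.exists_dual t x
    rw [coframeMetric_apply]
    refine lt_of_le_of_ne (Finset.sum_nonneg fun i _ => mul_self_nonneg _) fun h0 => hv ?_
    have h1 := (Finset.sum_eq_zero_iff_of_nonneg fun i _ => mul_self_nonneg (e i t x v)).1 h0.symm
    rw [eq_sum_of_dual hE v]
    exact Finset.sum_eq_zero fun i hi => by rw [mul_self_eq_zero.1 (h1 i hi), zero_smul]

theorem IsOrientedCoframeFamily.sharp_coframeMetric (he : IsOrientedCoframeFamily o e) {t : ℝ}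
    {x : S} {E : Fin 3 → TangentSpace (𝓡 3) x}
    (hE : ∀ i j, e i t x (E j) = if i = j then 1 else 0)
    (α : TangentSpace (𝓡 3) x →L[ℝ] ℝ) :
    sharp (coframeMetric e t x) α = ∑ i, α (E i) • E i := by
  refine sharp_eq ((he.isRiemannian t).self_ne_zero x) fun w => ?_
  conv_rhs => rw [eq_sum_of_dual hE w]
  rw [coframeMetric_apply]
  simp [hE, mul_comm]

theorem IsOrientedCoframeFamily.sharp_coframe (he : IsOrientedCoframeFamily o e) {t : ℝ}
    {x : S} {E : Fin 3 → TangentSpace (𝓡 3) x}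
    (hE : ∀ i j, e i t x (E j) = if i = j then 1 else 0) (i : Fin 3) :
    sharp (coframeMetric e t x) (e i t x) = E i := by
  rw [he.sharp_coframeMetric hE]
  simp [hE]

theorem IsOrientedCoframeFamily.smoothBilinFamily (he : IsOrientedCoframeFamily o e) :
    SmoothBilinFamily (coframeMetric e) := by
  refine smoothBilinFamily_iff.2 fun p₀ a b => ?_
  simp only [coframeMetric_apply]
  exact ContMDiffAt.sum fun i _ => (smoothOneFormFamily_iff.1 (he.smooth i) p₀ a).mul
    (smoothOneFormFamily_iff.1 (he.smooth i) p₀ b)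

end Coframes

/-! ### Covariant and time derivatives of the coframe metric. -/

section Derivatives

variable {S : Type*} [TopologicalSpace S] [ChartedSpace E3 S]

theorem coordVec_sum_smul {x : S} (r : Fin 3 → ℝ) (v : Fin 3 → TangentSpace (𝓡 3) x) :
    coordVec x (∑ i, r i • v i) = ∑ i, r i • coordVec x (v i) := by
  simp only [coordVec, map_sum, map_smul]
  rfl

theorem bilinInChart_symm {h : BilinField S} (hh : IsRiemannian h) (x : S) (z a b : E3) :
    bilinInChart h x z a b = bilinInChart h x z b a :=
  hh.symm _ _ _

theorem christoffel_symm {h : BilinField S} (hh : IsRiemannian h) (x : S) (c a b : E3) :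
    christoffel h x c a b = christoffel h x c b a := by
  simp only [christoffel, bilinInChart_symm hh x _ a b]
  ring

/-- The Levi-Civita connection is metric. -/
theorem christoffel_add_christoffel {h : BilinField S} (hh : IsRiemannian h) (x : S) (c a b : E3) :
    christoffel h x c a b + christoffel h x b a c =
      fderiv ℝ (fun z => bilinInChart h x z b c) (extChartAt (𝓡 3) x x) a := by
  simp only [christoffel, bilinInChart_symm hh x _ c b]
  ring

/-- The Levi-Civita connection is torsion-free. -/
theorem extDerivOneForm_eq_covDeriv_sub {h : BilinField S} (hh : IsRiemannian h)
    (α : OneFormField S) (x : S) (v w : TangentSpace (𝓡 3) x) :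
    extDerivOneForm α x v w = covDeriv h α x v w - covDeriv h α x w v := by
  simp only [extDerivOneForm, covDeriv, christoffel_symm hh x _ (coordVec x w)]
  ring

theorem bilinInChart_coframeMetric (e : Fin 3 → ℝ → OneFormField S) (t : ℝ) (x : S) (z a b : E3) :
    bilinInChart (coframeMetric e t) x z a b =
      ∑ i, formInChart (e i t) x z a * formInChart (e i t) x z b :=
  coframeMetric_apply e t _ _ _

variable [IsManifold (𝓡 3) ∞ S] {o : ManifoldOrientation S} {e : Fin 3 → ℝ → OneFormField S}

theorem IsOrientedCoframeFamily.differentiableAt_bilinInChart (he : IsOrientedCoframeFamily o e)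
    (t : ℝ) (x : S) (a b : E3) :
    DifferentiableAt ℝ (fun z => bilinInChart (coframeMetric e t) x z a b)
      (extChartAt (𝓡 3) x x) := by
  simp only [bilinInChart_coframeMetric]
  exact DifferentiableAt.fun_sum fun i _ =>
    ((he.smooth i).differentiableAt_formInChart t x a).mul
      ((he.smooth i).differentiableAt_formInChart t x b)

theorem IsOrientedCoframeFamily.fderiv_bilinInChart (he : IsOrientedCoframeFamily o e)
    (t : ℝ) (x : S) (c : E3) (v w : TangentSpace (𝓡 3) x) :
    fderiv ℝ (fun z => bilinInChart (coframeMetric e t) x z (coordVec x v) (coordVec x w))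
      (extChartAt (𝓡 3) x x) c =
    ∑ i, (fderiv ℝ (fun z => formInChart (e i t) x z (coordVec x v)) (extChartAt (𝓡 3) x x) c *
        e i t x w +
      fderiv ℝ (fun z => formInChart (e i t) x z (coordVec x w)) (extChartAt (𝓡 3) x x) c *
        e i t x v) := by
  have hd : ∀ i a, DifferentiableAt ℝ (fun z => formInChart (e i t) x z a)
      (extChartAt (𝓡 3) x x) := fun i a => (he.smooth i).differentiableAt_formInChart t x a
  simp only [bilinInChart_coframeMetric]
  rw [fderiv_fun_sum fun i _ => (hd i _).fun_mul (hd i _), sum_apply]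
  refine Finset.sum_congr rfl fun i _ => ?_
  rw [fderiv_fun_mul (hd i _) (hd i _)]
  simp only [formInChart_coordVec, add_apply, smul_apply, smul_eq_mul]
  ring

/-- Two of the three terms carry this slot inside the differentiated function, so linearity uses
differentiability of the metric components. -/
theorem IsOrientedCoframeFamily.christoffel_sum_smul (he : IsOrientedCoframeFamily o e) (t : ℝ)
    (x : S) (r : Fin 3 → ℝ) (c : Fin 3 → E3) (a b : E3) :
    christoffel (coframeMetric e t) x (∑ i, r i • c i) a b =
      ∑ i, r i * christoffel (coframeMetric e t) x (c i) a b := by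
  have h1 : ∀ a z, bilinInChart (coframeMetric e t) x z a (∑ i, r i • c i) =
      ∑ i, r i * bilinInChart (coframeMetric e t) x z a (c i) := fun a z => by
    let L : E3 →L[ℝ] ℝ := (coframeMetric e t _
      (mfderiv 𝓘(ℝ, E3) (𝓡 3) (extChartAt (𝓡 3) x).symm z a)).comp
        (mfderiv 𝓘(ℝ, E3) (𝓡 3) (extChartAt (𝓡 3) x).symm z)
    change L (∑ i, r i • c i) = ∑ i, r i * L (c i)
    simp only [map_sum, map_smul, smul_eq_mul]
  have h2 : ∀ a, fderiv ℝ (fun z => bilinInChart (coframeMetric e t) x z a (∑ i, r i • c i))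
      (extChartAt (𝓡 3) x x) = ∑ i, r i •
        fderiv ℝ (fun z => bilinInChart (coframeMetric e t) x z a (c i))
          (extChartAt (𝓡 3) x x) := fun a => by
    simp only [h1]
    rw [fderiv_fun_sum fun i _ => (he.differentiableAt_bilinInChart t x a (c i)).const_mul _]
    refine Finset.sum_congr rfl fun i _ => ?_
    rw [fderiv_const_mul (he.differentiableAt_bilinInChart t x a (c i))]
  simp only [christoffel, h2, map_sum, map_smul, sum_apply, smul_apply, smul_eq_mul]
  simp only [Fin.sum_univ_three]
  ring

/-- Differentiating `h = ∑ eᵢ ⊗ eᵢ` covariantly. -/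
theorem IsOrientedCoframeFamily.covDeriv_metric (he : IsOrientedCoframeFamily o e) (t : ℝ) (x : S)
    (v w z : TangentSpace (𝓡 3) x) :
    ∑ i, (covDeriv (coframeMetric e t) (e i t) x v w * e i t x z +
      covDeriv (coframeMetric e t) (e i t) x v z * e i t x w) = 0 := by
  obtain ⟨E, hE⟩ := he.exists_dual t x
  -- Contracting the slot `E i` with `e i` restores `z`; the Christoffel terms then add up to the
  -- derivative of `h`, which cancels the derivatives of the coframe components.
  have hΓ : ∀ w z : TangentSpace (𝓡 3) x,
      ∑ i, christoffel (coframeMetric e t) x (coordVec x (E i)) (coordVec x v) (coordVec x w) *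
        e i t x z =
      christoffel (coframeMetric e t) x (coordVec x z) (coordVec x v) (coordVec x w) := by
    intro w z
    conv_rhs => rw [eq_sum_of_dual hE z, coordVec_sum_smul, he.christoffel_sum_smul]
    exact Finset.sum_congr rfl fun i _ => mul_comm _ _
  have h1 := hΓ w z
  have h2 := hΓ z w
  have h3 := christoffel_add_christoffel (he.isRiemannian t) x (coordVec x z) (coordVec x v)
    (coordVec x w)
  rw [he.fderiv_bilinInChart] at h3
  simp only [covDeriv, he.sharp_coframe hE]
  simp only [Fin.sum_univ_three] at h1 h2 h3 ⊢
  linarith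

theorem IsOrientedCoframeFamily.covDeriv_smul (he : IsOrientedCoframeFamily o e) {f : S → ℝ}
    {t : ℝ} {x : S} (hf : ContMDiffAt (𝓡 3) 𝓘(ℝ, ℝ) ∞ f x) (i : Fin 3)
    (v w : TangentSpace (𝓡 3) x) :
    covDeriv (coframeMetric e t) (fun y => f y • e i t y) x v w =
      mvfderiv (𝓡 3) f x v * e i t x w + f x * covDeriv (coframeMetric e t) (e i t) x v w := by
  obtain ⟨E, hE⟩ := he.exists_dual t x
  have h1 : ∀ z a, formInChart (fun y => f y • e i t y) x z a =
      f ((extChartAt (𝓡 3) x).symm z) * formInChart (e i t) x z a := fun z a => rfl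
  have h2 : sharp (coframeMetric e t x) (f x • e i t x) = ∑ j, (f x * e i t x (E j)) • E j := by
    rw [he.sharp_coframeMetric hE]
    rfl
  have h3 : christoffel (coframeMetric e t) x
      (coordVec x (sharp (coframeMetric e t x) (f x • e i t x))) (coordVec x v) (coordVec x w) =
      f x * christoffel (coframeMetric e t) x
        (coordVec x (sharp (coframeMetric e t x) (e i t x))) (coordVec x v) (coordVec x w) := by
    rw [h2, he.sharp_coframeMetric hE, coordVec_sum_smul, coordVec_sum_smul,
      he.christoffel_sum_smul, he.christoffel_sum_smul, Finset.mul_sum]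
    exact Finset.sum_congr rfl fun j _ => mul_assoc _ _ _
  simp only [covDeriv, h1, h3]
  rw [fderiv_fun_mul (differentiableAt_comp_chart_symm hf)
    ((he.smooth i).differentiableAt_formInChart t x _), mvfderiv_eq_fderiv_chart hf]
  simp only [formInChart_coordVec, extChartAt_to_inv, add_apply, smul_apply, smul_eq_mul]
  ring

theorem IsOrientedCoframeFamily.deriv_coframeMetric (he : IsOrientedCoframeFamily o e) (t : ℝ) (x : S)
    (v w : TangentSpace (𝓡 3) x) :
    deriv (fun s => coframeMetric e s x v w) t =
      ∑ i, (deriv (fun s => e i s x v) t * e i t x w + e i t x v * deriv (fun s => e i s x w) t) := by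
  have hd : ∀ i v, DifferentiableAt ℝ (fun s => e i s x v) t :=
    fun i v => (he.smooth i).differentiable_apply x v t
  simp only [coframeMetric_apply]
  rw [deriv_fun_sum fun i _ => (hd i v).fun_mul (hd i w)]
  exact Finset.sum_congr rfl fun i _ => deriv_fun_mul (hd i v) (hd i w)

theorem IsOrientedCoframeFamily.shape_symm (he : IsOrientedCoframeFamily o e) (t : ℝ) (x : S)
    (v w : TangentSpace (𝓡 3) x) :
    shape (fun _ _ => 1) (coframeMetric e) t x v w =
      shape (fun _ _ => 1) (coframeMetric e) t x w v := by
  simp only [shape, (he.isRiemannian _).symm x v w]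

theorem IsOrientedCoframeFamily.shape_sum_smul (he : IsOrientedCoframeFamily o e) (t : ℝ) (x : S)
    (r : Fin 3 → ℝ) (v : Fin 3 → TangentSpace (𝓡 3) x) (w : TangentSpace (𝓡 3) x) :
    shape (fun _ _ => 1) (coframeMetric e) t x (∑ i, r i • v i) w =
      ∑ i, r i * shape (fun _ _ => 1) (coframeMetric e) t x (v i) w := by
  have hd : ∀ v, DifferentiableAt ℝ (fun s => coframeMetric e s x v w) t := fun v => by
    simp only [coframeMetric_apply]
    exact DifferentiableAt.fun_sum fun i _ =>
      ((he.smooth i).differentiable_apply x v t).mul ((he.smooth i).differentiable_apply x w t)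
  have h1 : (fun s => coframeMetric e s x (∑ i, r i • v i) w) =
      fun s => ∑ i, r i * coframeMetric e s x (v i) w := by
    funext s
    simp only [map_sum, map_smul, sum_apply, smul_apply, smul_eq_mul]
  simp only [shape]
  rw [h1, deriv_fun_sum fun i _ => (hd (v i)).const_mul _, Finset.mul_sum]
  refine Finset.sum_congr rfl fun i _ => ?_
  rw [deriv_const_mul _ (hd (v i))]
  ring

/-- `Θ = ∑ Θ(eᵢ) ⊗ eᵢ`. -/
theorem IsOrientedCoframeFamily.shape_eq_sum (he : IsOrientedCoframeFamily o e) (t : ℝ) (x : S)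
    (v w : TangentSpace (𝓡 3) x) :
    shape (fun _ _ => 1) (coframeMetric e) t x v w =
      ∑ i, coframeShapeForm e t (e i t) x v * e i t x w := by
  obtain ⟨E, hE⟩ := he.exists_dual t x
  rw [he.shape_symm]
  conv_lhs => rw [eq_sum_of_dual hE w, he.shape_sum_smul]
  simp only [coframeShapeForm, shapeForm, he.sharp_coframe hE]
  exact Finset.sum_congr rfl fun i _ => mul_comm _ _

theorem IsOrientedCoframeFamily.shapeForm_smul (he : IsOrientedCoframeFamily o e) (t : ℝ) (x : S)
    (f : S → ℝ) (i : Fin 3) (w : TangentSpace (𝓡 3) x) :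
    shapeForm (fun _ _ => 1) (coframeMetric e) t (fun y => f y • e i t y) x w =
      f x * coframeShapeForm e t (e i t) x w := by
  obtain ⟨E, hE⟩ := he.exists_dual t x
  simp only [coframeShapeForm, shapeForm]
  rw [he.sharp_coframeMetric hE, he.sharp_coframeMetric hE, he.shape_sum_smul, he.shape_sum_smul,
    Finset.mul_sum]
  refine Finset.sum_congr rfl fun j _ => ?_
  rw [smul_apply, smul_eq_mul, mul_assoc]

/-- Differentiating `h = ∑ eᵢ ⊗ eᵢ` in time. -/
theorem IsOrientedCoframeFamily.evolution_metric (he : IsOrientedCoframeFamily o e) (t : ℝ) (x : S)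
    (v w : TangentSpace (𝓡 3) x) :
    ∑ i, ((deriv (fun s => e i s x v) t + coframeShapeForm e t (e i t) x v) * e i t x w +
      (deriv (fun s => e i s x w) t + coframeShapeForm e t (e i t) x w) * e i t x v) = 0 := by
  -- The two expansions of the symmetric `Θ` add up to `-∂_t h`.
  have h1 := he.shape_eq_sum t x v w
  have h2 := he.shape_eq_sum t x w v
  rw [he.shape_symm] at h2
  have h3 := he.deriv_coframeMetric t x v w
  simp only [shape] at h1 h2
  simp only [Fin.sum_univ_three] at h1 h2 h3 ⊢
  linarith

end Derivatives

/-! ### From a comoving flow to the coframe equations. -/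

section FlowToCoframe

variable {S : Type*} [TopologicalSpace S] [ChartedSpace E3 S] [IsManifold (𝓡 3) ∞ S]
  {o : ManifoldOrientation S} {e : Fin 3 → ℝ → OneFormField S} {F : ParallelSpinorFlow S}

/-- The function `u⁰` of a comoving flow is constant in time and the coframe evolves by `Θ`. -/
theorem IsAdapted.evolution (hF : F.IsComoving) (he : IsOrientedCoframeFamily o e)
    (ha : IsAdapted F e) (t : ℝ) (x : S) :
    deriv (fun s => F.u0 s x) t = 0 ∧ ∀ i (v : TangentSpace (𝓡 3) x),
      deriv (fun s => e i s x v) t + coframeShapeForm e t (e i t) x v = 0 := by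
  have hlapse : F.lapse = fun _ _ => 1 := by funext t x; exact hF t x
  have hh : F.h = coframeMetric e := funext ha.metric
  have hu : F.u = fun t x => F.u0 t x • e 0 t x := by funext t x; exact ha.u_eq t x
  have hl : F.l = e 1 := by funext t x; exact ha.l_eq t x
  have hd : ∀ v : TangentSpace (𝓡 3) x, DifferentiableAt ℝ (fun s => e 0 s x v) t :=
    fun v => (he.smooth 0).differentiable_apply x v t
  have hd0 : DifferentiableAt ℝ (fun s => F.u0 s x) t := F.smooth_u0.differentiable x t
  have h0 : ∀ v : TangentSpace (𝓡 3) x, deriv (fun s => F.u0 s x) t * e 0 t x v +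
      F.u0 t x * (deriv (fun s => e 0 s x v) t + coframeShapeForm e t (e 0 t) x v) = 0 := by
    intro v
    have := F.evolution_u t x v
    rw [hlapse, hh, hu, he.shapeForm_smul] at this
    simp only [smul_apply, smul_eq_mul, mvfderiv_const, zero_apply, mul_zero, one_mul] at this
    rw [deriv_fun_mul hd0 (hd v)] at this
    linarith
  have h1 : ∀ v : TangentSpace (𝓡 3) x,
      deriv (fun s => e 1 s x v) t + coframeShapeForm e t (e 1 t) x v = 0 := by
    intro v
    have := F.evolution_l t x v
    rw [hlapse, hh, hl] at this
    simp only [mvfderiv_const, zero_apply, zero_mul, add_zero, one_mul, ← mul_add] at this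
    exact (mul_eq_zero.1 this).resolve_left (F.u0_ne_zero t x)
  obtain ⟨E, hE⟩ := he.exists_dual t x
  have hA := he.evolution_metric t x
  -- Skewness at `(E 0, E 0)` makes the `e_u`-component of the defect vanish, isolating `∂_t u⁰`.
  have hu0 : deriv (fun s => F.u0 s x) t = 0 := by
    have k1 := hA (E 0) (E 0)
    have k2 := h0 (E 0)
    simp [Fin.sum_univ_three, hE] at k1 k2
    have k3 : deriv (fun s => e 0 s x (E 0)) t + coframeShapeForm e t (e 0 t) x (E 0) = 0 := by
      linarith
    rwa [k3, mul_zero, add_zero] at k2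
  have h0' : ∀ v : TangentSpace (𝓡 3) x,
      deriv (fun s => e 0 s x v) t + coframeShapeForm e t (e 0 t) x v = 0 := by
    intro v
    have := h0 v
    rw [hu0, zero_mul, zero_add] at this
    exact (mul_eq_zero.1 this).resolve_left (F.u0_ne_zero t x)
  refine ⟨hu0, fun i v => ?_⟩
  fin_cases i
  · exact h0' v
  · exact h1 v
  -- Two rows of the skew matrix of defects vanish; its last diagonal entry vanishes as well, so the
  -- third row does too.
  · have k1 := hA (E 2) (E 2)
    have k2 := hA v (E 2)
    simp only [Fin.sum_univ_three, h0', h1, hE] at k1 k2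
    simp at k1 k2
    have k3 : deriv (fun s => e 2 s x (E 2)) t + coframeShapeForm e t (e 2 t) x (E 2) = 0 := by
      linarith
    rw [k3, zero_mul, add_zero] at k2
    exact k2

/-- The covariant derivatives of the coframe of a comoving flow, and the differential of `u⁰`. -/
theorem IsAdapted.covDeriv_eq (hF : F.IsComoving) (he : IsOrientedCoframeFamily o e)
    (ha : IsAdapted F e) (t : ℝ) (x : S) :
    (∀ v : TangentSpace (𝓡 3) x,
      mvfderiv (𝓡 3) (F.u0 t) x v = -(F.u0 t x * coframeShapeForm e t (e 0 t) x v)) ∧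
    (∀ v w : TangentSpace (𝓡 3) x, covDeriv (coframeMetric e t) (e 0 t) x v w =
      coframeShapeForm e t (e 0 t) x v * e 0 t x w -
        shape (fun _ _ => 1) (coframeMetric e) t x v w) ∧
    (∀ v w : TangentSpace (𝓡 3) x, covDeriv (coframeMetric e t) (e 1 t) x v w =
      coframeShapeForm e t (e 1 t) x v * e 0 t x w) ∧
    (∀ v w : TangentSpace (𝓡 3) x, covDeriv (coframeMetric e t) (e 2 t) x v w =
      coframeShapeForm e t (e 2 t) x v * e 0 t x w) := by
  have hlapse : F.lapse = fun _ _ => 1 := by funext t x; exact hF t x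
  have hh : F.h = coframeMetric e := funext ha.metric
  have hu : F.u = fun t x => F.u0 t x • e 0 t x := by funext t x; exact ha.u_eq t x
  have hl : F.l = e 1 := by funext t x; exact ha.l_eq t x
  obtain ⟨E, hE⟩ := he.exists_dual t x
  have hB := he.covDeriv_metric t x
  have hne := F.u0_ne_zero t x
  have c0 : ∀ v w : TangentSpace (𝓡 3) x, mvfderiv (𝓡 3) (F.u0 t) x v * e 0 t x w +
      F.u0 t x * covDeriv (coframeMetric e t) (e 0 t) x v w +
      F.u0 t x * shape (fun _ _ => 1) (coframeMetric e) t x v w = 0 := by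
    intro v w
    have := F.constraint_u t x v w
    rw [hlapse, hh, hu] at this
    rw [← he.covDeriv_smul (F.smooth_u0.contMDiff t x)]
    exact this
  have c1 : ∀ v w : TangentSpace (𝓡 3) x, covDeriv (coframeMetric e t) (e 1 t) x v w =
      coframeShapeForm e t (e 1 t) x v * e 0 t x w := by
    intro v w
    have := F.constraint_l t x v w
    rw [hlapse, hh, hu, hl] at this
    refine mul_left_cancel₀ hne (this.trans ?_)
    rw [smul_apply, smul_eq_mul, coframeShapeForm]
    ring
  have du : ∀ v : TangentSpace (𝓡 3) x,
      mvfderiv (𝓡 3) (F.u0 t) x v = -(F.u0 t x * coframeShapeForm e t (e 0 t) x v) := by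
    intro v
    -- As `e_u` has unit length, `∇_v e_u` has no `e_u`-component, so evaluation at `E 0` leaves
    -- only `du⁰ + u⁰ Θ(e_u)`.
    have k1 := hB v (E 0) (E 0)
    have k2 := c0 v (E 0)
    rw [he.shape_eq_sum] at k2
    simp [Fin.sum_univ_three, hE] at k1 k2
    have k3 : covDeriv (coframeMetric e t) (e 0 t) x v (E 0) = 0 := by linarith
    rw [k3] at k2
    linarith
  have c0' : ∀ v w : TangentSpace (𝓡 3) x, covDeriv (coframeMetric e t) (e 0 t) x v w =
      coframeShapeForm e t (e 0 t) x v * e 0 t x w -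
        shape (fun _ _ => 1) (coframeMetric e) t x v w := by
    intro v w
    have := c0 v w
    rw [du v] at this
    refine mul_left_cancel₀ hne ?_
    linarith
  refine ⟨du, c0', c1, fun v w => ?_⟩
  -- The components of `∇_v e_n` along `e_u` and `e_l` are minus the `e_n`-components of `∇_v e_u`
  -- and `∇_v e_l`; that along `e_n` is zero.
  have k1 := hB v (E 2) (E 2)
  have k2 := hB v w (E 2)
  have k3 := c0' v (E 2)
  have k4 := c1 v (E 2)
  rw [he.shape_eq_sum] at k3
  simp [Fin.sum_univ_three, hE] at k1 k2 k3 k4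
  have k5 : covDeriv (coframeMetric e t) (e 2 t) x v (E 2) = 0 := by linarith
  rw [k3, k4, k5] at k2
  linarith

theorem IsAdapted.comovingFlowEquations (hF : F.IsComoving) (he : IsOrientedCoframeFamily o e)
    (ha : IsAdapted F e) : ComovingFlowEquations e where
  evolution i t x v := (ha.evolution hF he t x).2 i v
  structure_eq i t x v w := by
    obtain ⟨-, h0, h1, h2⟩ := ha.covDeriv_eq hF he t x
    rw [extDerivOneForm_eq_covDeriv_sub (he.isRiemannian t)]
    fin_cases i
    · have := he.shape_symm t x v w
      simp only [Fin.zero_eta, h0, this]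
      ring
    · simp only [Fin.mk_one, h1]
    · simp only [Fin.reduceFinMk, h2]
  exact t := by
    -- `Real.log r` is `log |r|`, so `-log u⁰` is a primitive of `Θ(e_u)` whatever the sign of `u⁰`.
    have hs : ∀ x, HasDerivAt (fun r => -Real.log r) (-(F.u0 t x)⁻¹) (F.u0 t x) :=
      fun x => (Real.hasDerivAt_log (F.u0_ne_zero t x)).neg
    refine ⟨fun x => -Real.log (F.u0 t x), fun x => ?_, fun x v => ?_⟩
    · exact ContMDiffAt.comp (g := fun r => -Real.log r) x
        (Real.contDiffAt_log.2 (F.u0_ne_zero t x)).neg.contMDiffAt (F.smooth_u0.contMDiff t x)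
    · have hd := (F.smooth_u0.contMDiff t x).mdifferentiableAt (by simp)
      have key : mvfderiv (𝓡 3) (fun x => -Real.log (F.u0 t x)) x v =
          -(F.u0 t x)⁻¹ * mvfderiv (𝓡 3) (F.u0 t) x v := by
        have := mfderiv_comp x (hs x).differentiableAt.mdifferentiableAt hd
        rw [mfderiv_eq_fderiv, (hs x).hasFDerivAt.fderiv] at this
        refine (congrArg (fun L => L v) this).trans ?_
        exact mul_comm (mvfderiv (𝓡 3) (F.u0 t) x v) _
      rw [key, (ha.covDeriv_eq hF he t x).1 v]
      field_simp [F.u0_ne_zero t x]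
  stationary t x v := by
    have hconst : ∀ s, F.u0 s = F.u0 0 := by
      intro s
      funext y
      exact is_const_of_deriv_eq_zero (F.smooth_u0.differentiable y)
        (fun r => (ha.evolution hF he r y).1) s 0
    have key : (fun s => coframeShapeForm e s (e 0 s) x v) =
        fun _ => -(F.u0 0 x)⁻¹ * mvfderiv (𝓡 3) (F.u0 0) x v := by
      funext s
      have := (ha.covDeriv_eq hF he s x).1 v
      rw [hconst s] at this
      rw [this]
      field_simp [F.u0_ne_zero 0 x]
    rw [key, deriv_const]

end FlowToCoframe

/-! ### From the coframe equations to a comoving flow. -/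

section CoframeToFlow

variable {S : Type*} [TopologicalSpace S] [ChartedSpace E3 S] [IsManifold (𝓡 3) ∞ S]
  {o : ManifoldOrientation S} {e : Fin 3 → ℝ → OneFormField S}

/-- The structure equations determine the connection forms. -/
theorem ComovingFlowEquations.covDeriv_eq (hc : ComovingFlowEquations e)
    (he : IsOrientedCoframeFamily o e) (i : Fin 3) (t : ℝ) (x : S) (v w : TangentSpace (𝓡 3) x) :
    covDeriv (coframeMetric e t) (e i t) x v w = coframeShapeForm e t (e i t) x v * e 0 t x w -
      if i = 0 then shape (fun _ _ => 1) (coframeMetric e) t x v w else 0 := by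
  obtain ⟨E, hE⟩ := he.exists_dual t x
  -- The candidate connection has the prescribed antisymmetric part, so the difference `D` is
  -- symmetric. It is skew because `Θ = ∑ Θ(eᵢ) ⊗ eᵢ` makes the extra `-Θ` at `i = 0` balance the
  -- terms `Θ(eᵢ) ⊗ e_u`.
  have key := eq_zero_of_symm_of_skew (c := fun i => e i t x) hE
    (D := fun i v w => covDeriv (coframeMetric e t) (e i t) x v w -
      (coframeShapeForm e t (e i t) x v * e 0 t x w -
        if i = 0 then shape (fun _ _ => 1) (coframeMetric e) t x v w else 0)) ?_ ?_ i v w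
  · exact sub_eq_zero.1 key
  · intro i v w
    have h1 := hc.structure_eq i t x v w
    rw [extDerivOneForm_eq_covDeriv_sub (he.isRiemannian t)] at h1
    simp only [he.shape_symm t x v w]
    linarith
  · intro v w z
    have h1 := he.covDeriv_metric t x v w z
    have h2 := he.shape_eq_sum t x v w
    have h3 := he.shape_eq_sum t x v z
    simp only [Fin.sum_univ_three, if_true, one_ne_zero, if_false,
      show (2 : Fin 3) ≠ 0 by decide] at h1 h2 h3 ⊢
    rw [h2, h3]
    linarith

/-- A zero `deriv` gives constancy only for a differentiable function; the evolution equation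
supplies this by identifying `Θ(e_u)` with `-∂_t e_u`, the derivative of a smooth function of time.
-/
theorem ComovingFlowEquations.shapeForm_eq (hc : ComovingFlowEquations e)
    (he : IsOrientedCoframeFamily o e) (t s : ℝ) (x : S) (v : TangentSpace (𝓡 3) x) :
    coframeShapeForm e s (e 0 s) x v = coframeShapeForm e t (e 0 t) x v := by
  have h1 : (fun s => coframeShapeForm e s (e 0 s) x v) =
      fun s => -deriv (fun r => e 0 r x v) s := by
    funext s
    linarith [hc.evolution 0 s x v]
  have h2 : Differentiable ℝ (fun s => coframeShapeForm e s (e 0 s) x v) := by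
    rw [h1]
    exact (((contDiff_infty_iff_deriv.1 ((he.smooth 0).contDiff_apply x v)).2).differentiable
      (by simp)).neg
  exact is_const_of_deriv_eq_zero h2 (fun r => hc.stationary r x v) s t

/-- The one unknown is `u⁰`, subject to `du⁰ = -u⁰ Θ(e_u)` and `∂_t u⁰ = 0`. The function `exp(-f)`,
with `f` a primitive of `Θ(e_u)` at time `0`, satisfies both. -/
theorem ComovingFlowEquations.exists_flow (hc : ComovingFlowEquations e)
    (he : IsOrientedCoframeFamily o e) :
    ∃ F : ParallelSpinorFlow S, F.IsComoving ∧ IsAdapted F e := by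
  obtain ⟨f, hf, hdf⟩ := hc.exact 0
  have hsmooth : ContMDiff (𝓡 3) 𝓘(ℝ, ℝ) ∞ (fun x => Real.exp (-f x)) :=
    ContMDiff.comp (g := fun r => Real.exp (-r)) (Real.contDiff_exp.comp contDiff_neg).contMDiff hf
  have hd : ∀ x (v : TangentSpace (𝓡 3) x), mvfderiv (𝓡 3) (fun x => Real.exp (-f x)) x v =
      -(Real.exp (-f x) * mvfderiv (𝓡 3) f x v) := by
    intro x v
    have hs : HasDerivAt (fun r => Real.exp (-r)) (Real.exp (-f x) * -1) (f x) :=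
      (hasDerivAt_neg (f x)).exp
    have := mfderiv_comp x hs.differentiableAt.mdifferentiableAt
      ((hf x).mdifferentiableAt (by simp))
    rw [mfderiv_eq_fderiv, hs.hasFDerivAt.fderiv] at this
    refine (congrArg (fun L => L v) this).trans ?_
    change mvfderiv (𝓡 3) f x v * (Real.exp (-f x) * -1) = _
    ring
  have hdu : ∀ t x (v : TangentSpace (𝓡 3) x), mvfderiv (𝓡 3) (fun x => Real.exp (-f x)) x v =
      -(Real.exp (-f x) * coframeShapeForm e t (e 0 t) x v) := by
    intro t x v
    rw [hd, hdf, hc.shapeForm_eq he t 0]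
  refine ⟨{
    lapse := fun _ _ => 1
    h := coframeMetric e
    u0 := fun _ x => Real.exp (-f x)
    u := fun t x => Real.exp (-f x) • e 0 t x
    l := e 1
    smooth_lapse := contMDiff_const
    smooth_h := he.smoothBilinFamily
    smooth_u0 := hsmooth.comp contMDiff_snd
    smooth_u := ?_
    smooth_l := he.smooth 1
    lapse_ne_zero := fun _ _ => one_ne_zero
    riemannian := he.isRiemannian
    u0_ne_zero := fun _ _ => Real.exp_ne_zero _
    evolution_u := ?_
    evolution_l := ?_
    constraint_u := ?_
    constraint_l := ?_
    norm_u := ?_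
    norm_l := ?_
    orthogonal := ?_ }, fun _ _ => rfl, fun _ => rfl, fun _ _ => rfl, fun _ _ => rfl⟩
  · refine smoothOneFormFamily_iff.2 fun p₀ a => ?_
    exact ((hsmooth.comp contMDiff_snd) p₀).mul (smoothOneFormFamily_iff.1 (he.smooth 0) p₀ a)
  · intro t x v
    rw [he.shapeForm_smul t x (fun x => Real.exp (-f x))]
    simp only [smul_apply, smul_eq_mul, mvfderiv_const, zero_apply, mul_zero, one_mul]
    rw [deriv_const_mul _ ((he.smooth 0).differentiable_apply x v t), ← mul_add,
      hc.evolution 0 t x v, mul_zero]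
  · intro t x v
    have := hc.evolution 1 t x v
    simp only [mvfderiv_const, zero_apply, zero_mul, add_zero, one_mul, ← mul_add]
    exact mul_eq_zero_of_right _ this
  · intro t x v w
    rw [he.covDeriv_smul (hsmooth x), hdu t, hc.covDeriv_eq he, if_pos rfl]
    ring
  · intro t x v w
    rw [hc.covDeriv_eq he, if_neg one_ne_zero, smul_apply, smul_eq_mul, coframeShapeForm]
    ring
  · intro t x
    obtain ⟨E, hE⟩ := he.exists_dual t x
    rw [formInner, he.sharp_coframeMetric hE]
    simp [hE, sq]
  · intro t x
    obtain ⟨E, hE⟩ := he.exists_dual t x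
    rw [formInner, he.sharp_coframe hE]
    simp [hE]
  · intro t x
    obtain ⟨E, hE⟩ := he.exists_dual t x
    rw [formInner, he.sharp_coframe hE]
    simp [hE]

end CoframeToFlow

/-! ### Completing an orthonormal pair at a point. -/

section ThirdCovector

variable {V : Type*} [AddCommGroup V] [Module ℝ V]

theorem det_apply_basis_eq (c : Fin 3 → V →ₗ[ℝ] ℝ) (b : Module.Basis (Fin 3) ℝ V) (E : Fin 3 → V) :
    (Matrix.of fun i j => c i (E j)).det = (Matrix.of fun i j => c i (b j)).det * b.det E := by
  rw [Module.Basis.det_apply, ← Matrix.det_mul]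
  congr 1
  ext i j
  conv_lhs => rw [Matrix.of_apply, ← b.sum_repr (E j), map_sum]
  simp [Matrix.mul_apply, Module.Basis.toMatrix_apply, mul_comm]

variable [TopologicalSpace V]

/-- An orthonormal pair of covectors extends to an oriented orthonormal coframe. -/
theorem exists_oriented_third_covector (hV : Module.finrank ℝ V = 3) (o : Orientation ℝ V (Fin 3))
    {h : V →L[ℝ] V →L[ℝ] ℝ} (hsymm : ∀ v w, h v w = h w v) (hpos : ∀ v, v ≠ 0 → 0 < h v v)
    {c₀ c₁ : V →L[ℝ] ℝ} {E₀ E₁ : V} (h₀ : ∀ w, h E₀ w = c₀ w) (h₁ : ∀ w, h E₁ w = c₁ w)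
    (h₀₀ : c₀ E₀ = 1) (h₁₁ : c₁ E₁ = 1) (h₀₁ : c₀ E₁ = 0) :
    ∃ n : V →L[ℝ] ℝ, (∀ v w, h v w = c₀ v * c₀ w + c₁ v * c₁ w + n v * n w) ∧
      ∀ b : Module.Basis (Fin 3) ℝ V, b.orientation = o →
        0 < (Matrix.of fun i j => (![c₀, c₁, n] i) (b j)).det := by
  have : FiniteDimensional ℝ V := Module.finite_of_finrank_eq_succ hV
  have h₁₀ : c₁ E₀ = 0 := by rw [← h₁, hsymm, h₀, h₀₁]
  -- Two covectors on a three-dimensional space have a common nonzero kernel vector; normalised, it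
  -- is the third frame vector.
  obtain ⟨k, hk0, hk, hk'⟩ : ∃ k : V, k ≠ 0 ∧ c₀ k = 0 ∧ c₁ k = 0 := by
    have hker := LinearMap.ker_ne_bot_of_finrank_lt
      (f := LinearMap.prod c₀.toLinearMap c₁.toLinearMap) (by simp [hV])
    obtain ⟨k, hk, hk0⟩ := Submodule.exists_mem_ne_zero_of_ne_bot hker
    have hk' : (c₀ k, c₁ k) = (0, 0) := hk
    exact ⟨k, hk0, congrArg Prod.fst hk', congrArg Prod.snd hk'⟩
  have hr := hpos k hk0
  set E₂ : V := (Real.sqrt (h k k))⁻¹ • k with hE₂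
  have hsq := Real.sqrt_pos.2 hr
  have e02 : c₀ E₂ = 0 := by simp [hE₂, hk]
  have e12 : c₁ E₂ = 0 := by simp [hE₂, hk']
  have e22 : h E₂ E₂ = 1 := by
    simp only [hE₂, map_smul, smul_apply, smul_eq_mul]
    field_simp
    rw [Real.sq_sqrt hr.le]
  have e20 : h E₂ E₀ = 0 := by rw [hsymm, h₀, e02]
  have e21 : h E₂ E₁ = 0 := by rw [hsymm, h₁, e12]
  have hbi : ∀ i j, (fun i => (![c₀, c₁, h E₂] i).toLinearMap) i (![E₀, E₁, E₂] j) =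
      if i = j then (1 : ℝ) else 0 := by
    intro i j
    fin_cases i <;> fin_cases j <;> simp [h₀₀, h₁₁, h₀₁, h₁₀, e02, e12, e22, e20, e21]
  have hexp := eq_sum_of_biorthogonal hV hbi
  have hmet : ∀ v w, h v w = c₀ v * c₀ w + c₁ v * c₁ w + h E₂ v * h E₂ w := by
    intro v w
    conv_lhs => rw [hexp v]
    simp [Fin.sum_univ_three, h₀, h₁]
  have hne : ∀ b : Module.Basis (Fin 3) ℝ V,
      (Matrix.of fun i j => (![c₀, c₁, h E₂] i) (b j)).det ≠ 0 := by
    intro b hb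
    have h1 := det_apply_basis_eq (fun i => (![c₀, c₁, h E₂] i).toLinearMap) b ![E₀, E₁, E₂]
    have h2 : (Matrix.of fun i j => (fun i => (![c₀, c₁, h E₂] i).toLinearMap) i
        (![E₀, E₁, E₂] j)) = 1 := by
      ext i j
      rw [Matrix.of_apply, hbi, Matrix.one_apply]
    rw [h2, Matrix.det_one] at h1
    refine one_ne_zero (h1.trans ?_)
    exact mul_eq_zero_of_left hb _
  let b₀ : Module.Basis (Fin 3) ℝ V :=
    (Module.finBasisOfFinrankEq ℝ _ hV).adjustToOrientation o
  have hb₀ : b₀.orientation = o := Module.Basis.orientation_adjustToOrientation _ _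
  have hdet : ∀ n : V →L[ℝ] ℝ, 0 < (Matrix.of fun i j => (![c₀, c₁, n] i) (b₀ j)).det →
      ∀ b : Module.Basis (Fin 3) ℝ V, b.orientation = o →
        0 < (Matrix.of fun i j => (![c₀, c₁, n] i) (b j)).det := by
    intro n hn b hb
    have h1 := det_apply_basis_eq (fun i => (![c₀, c₁, n] i).toLinearMap) b₀ b
    have h2 := (b₀.orientation_eq_iff_det_pos b).1 (hb₀.trans hb.symm)
    exact (mul_pos hn h2).trans_eq h1.symm
  -- Replacing `n` by `-n` preserves `n ⊗ n` and flips the determinant, so one of the two signs is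
  -- oriented.
  rcases lt_or_gt_of_ne (hne b₀) with hneg | hpos'
  · refine ⟨-h E₂, fun v w => ?_, hdet _ ?_⟩
    · rw [hmet v w]
      simp
    · rw [Matrix.det_fin_three] at hneg ⊢
      simp at hneg ⊢
      linarith
  · exact ⟨h E₂, hmet, hdet _ hpos'⟩

end ThirdCovector

/-! ### Smooth dependence of the third covector. -/

section Smoothness

variable {S : Type*} [TopologicalSpace S] [ChartedSpace E3 S] [IsManifold (𝓡 3) ∞ S]
  {o : ManifoldOrientation S} {e : Fin 3 → ℝ → OneFormField S}

/-- Near every point there is an oriented frame with constant components in the preferred chart. -/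
theorem eventually_oriented_frameVec (o : ManifoldOrientation S) (x₀ : S) :
    ∃ a : Fin 3 → E3, ∀ᶠ y in 𝓝 x₀, ∃ b : Module.Basis (Fin 3) ℝ (TangentSpace (𝓡 3) y),
      b.orientation = o.at' y ∧ ∀ j, b j = frameVec x₀ y (a j) := by
  obtain ⟨b₀, hb₀⟩ := exists_oriented_basis o x₀
  set T := trivializationAt E3 (TangentSpace (𝓡 3)) x₀ with hT
  have hx₀ : x₀ ∈ T.baseSet := mem_baseSet_trivializationAt E3 (TangentSpace (𝓡 3)) x₀
  set a := b₀.map (T.continuousLinearEquivAt ℝ x₀ hx₀).toLinearEquiv with ha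
  refine ⟨a, ?_⟩
  filter_upwards [T.open_baseSet.mem_nhds hx₀, o.locally_constant x₀] with y hy hoy
  have hoy := hoy hy
  refine ⟨a.map (T.continuousLinearEquivAt ℝ y hy).toLinearEquiv.symm, ?_, fun j => ?_⟩
  · rw [Module.Basis.orientation_map, ha, Module.Basis.orientation_map, hb₀, ← hoy]
    exact (Orientation.map (Fin 3)
      (T.continuousLinearEquivAt ℝ y hy).toLinearEquiv).symm_apply_apply _
  · rw [Module.Basis.map_apply]
    simp only [frameVec, ← hT]
    rw [← T.symm_continuousLinearEquivAt_eq hy]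
    rfl

/-- The third covector of an oriented coframe depends smoothly on the metric and the first two. -/
theorem smoothOneFormFamily_third (h0 : SmoothOneFormFamily (e 0)) (h1 : SmoothOneFormFamily (e 1))
    (hh : SmoothBilinFamily (coframeMetric e))
    (ho : ∀ t x (b : Module.Basis (Fin 3) ℝ (TangentSpace (𝓡 3) x)),
      b.orientation = o.at' x → 0 < (Matrix.of fun i j => e i t x (b j)).det) :
    SmoothOneFormFamily (e 2) := by
  refine smoothOneFormFamily_iff.2 fun p₀ c => ?_
  let ε : Fin 3 → E3 → ℝ × S → ℝ := fun i a p => e i p.1 p.2 (frameVec p₀.2 p.2 a)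
  -- `Q` is `e_n ⊗ e_n`, written in data already known to be smooth. Where `e_n(a) > 0`, `e_n(c)` is
  -- recovered as `Q a c / √(Q a a)`.
  let Q : E3 → E3 → ℝ × S → ℝ := fun a b p =>
    coframeMetric e p.1 p.2 (frameVec p₀.2 p.2 a) (frameVec p₀.2 p.2 b) -
      (ε 0 a p * ε 0 b p + ε 1 a p * ε 1 b p)
  have hε0 : ∀ a, ContMDiffAt (𝓘(ℝ, ℝ).prod (𝓡 3)) 𝓘(ℝ, ℝ) ∞ (ε 0 a) p₀ :=
    smoothOneFormFamily_iff.1 h0 p₀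
  have hε1 : ∀ a, ContMDiffAt (𝓘(ℝ, ℝ).prod (𝓡 3)) 𝓘(ℝ, ℝ) ∞ (ε 1 a) p₀ :=
    smoothOneFormFamily_iff.1 h1 p₀
  have hQ : ∀ a b, ContMDiffAt (𝓘(ℝ, ℝ).prod (𝓡 3)) 𝓘(ℝ, ℝ) ∞ (Q a b) p₀ := fun a b =>
    (smoothBilinFamily_iff.1 hh p₀ a b).sub
      (((hε0 a).mul (hε0 b)).add ((hε1 a).mul (hε1 b)))
  have hQe : ∀ a b p, Q a b p = ε 2 a p * ε 2 b p := by
    intro a b p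
    simp only [Q, ε, coframeMetric_apply, Fin.sum_univ_three]
    ring
  obtain ⟨a, ha⟩ : ∃ a, ε 2 a p₀ = 1 := by
    obtain ⟨b, hb⟩ := exists_oriented_basis o p₀.2
    obtain ⟨E, hE⟩ := exists_biorthogonal (c := fun i => (e i p₀.1 p₀.2).toLinearMap) b
      (ho p₀.1 p₀.2 b hb).ne'
    refine ⟨coordVec p₀.2 (E 2), ?_⟩
    simp only [ε, frameVec_coordVec]
    simpa using hE 2 2
  obtain ⟨f, hf⟩ := eventually_oriented_frameVec o p₀.2
  have hf' : ∀ᶠ p : ℝ × S in 𝓝 p₀, 0 < (Matrix.of fun i j => ε i (f j) p).det := by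
    filter_upwards [(continuous_snd (X := ℝ) (Y := S)).continuousAt.eventually hf] with p hp
    obtain ⟨b, hb, hbf⟩ := hp
    have := ho p.1 p.2 b hb
    simpa only [hbf] using this
  -- Continuity of `e_n` is not yet available, so the sign of `e_n(a)` near `p₀` is read from `G =
  -- e_n(a) · det e`: it is polynomial in smooth data, and `det e` is positive on the oriented
  -- frame.
  let G : ℝ × S → ℝ := fun p => (Matrix.of ![fun j => ε 0 (f j) p, fun j => ε 1 (f j) p,
    fun j => Q a (f j) p]).det
  have hGe : ∀ p, G p = ε 2 a p * (Matrix.of fun i j => ε i (f j) p).det := by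
    intro p
    simp only [G, Matrix.det_fin_three, hQe]
    simp
    ring
  have hGc : ContinuousAt G p₀ := by
    have k0 := fun a => (hε0 a).continuousAt
    have k1 := fun a => (hε1 a).continuousAt
    have k2 := fun a b => (hQ a b).continuousAt
    simp only [G, Matrix.det_fin_three]
    simp
    fun_prop
  have hG : ∀ᶠ p in 𝓝 p₀, 0 < G p := by
    refine hGc.eventually (lt_mem_nhds ?_)
    rw [hGe, ha, one_mul]
    exact hf'.self_of_nhds
  have hpos : ∀ᶠ p in 𝓝 p₀, 0 < ε 2 a p := by
    filter_upwards [hG, hf'] with p hp hp'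
    rw [hGe] at hp
    exact (pos_iff_pos_of_mul_pos hp).2 hp'
  have hQa : Q a a p₀ = 1 := by rw [hQe, ha, one_mul]
  have hsqrt : ContMDiffAt (𝓘(ℝ, ℝ).prod (𝓡 3)) 𝓘(ℝ, ℝ) ∞ (fun p => Real.sqrt (Q a a p)) p₀ :=
    ContMDiffAt.comp (g := Real.sqrt) p₀
      (Real.contDiffAt_sqrt (by rw [hQa]; exact one_ne_zero)).contMDiffAt (hQ a a)
  refine ((hQ a c).div₀ hsqrt (by rw [hQa]; simp)).congr_of_eventuallyEq ?_
  filter_upwards [hpos] with p hp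
  change ε 2 c p = Q a c p / Real.sqrt (Q a a p)
  rw [hQe, hQe, Real.sqrt_mul_self hp.le, mul_div_cancel_left₀ _ hp.ne']

end Smoothness

/-! ### Existence and uniqueness of the adapted coframe. -/

section AdaptedCoframes

variable {S : Type*} [TopologicalSpace S] [ChartedSpace E3 S]

/-- Both expressions share the `dt ⊗ dt` term, and the vectors `(0, v)` tangent to the slices
recover `h`. -/
theorem IsStandardMetric.unique {g : SpacetimeBilinField S} {lapse : ℝ → S → ℝ}
    {h h' : ℝ → BilinField S} (H : IsStandardMetric g lapse h) (H' : IsStandardMetric g lapse h') :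
    h = h' := by
  funext t x
  ext v w
  let i : TangentSpace (𝓡 3) x → TangentSpace (𝓘(ℝ, ℝ).prod (𝓡 3)) ((t, x) : ℝ × S) :=
    fun v => ((0 : ℝ), v)
  have hi : ∀ v, mfderiv (𝓘(ℝ, ℝ).prod (𝓡 3)) (𝓡 3) (Prod.snd : ℝ × S → S) (t, x) (i v) = v := by
    intro v
    rw [mfderiv_snd]
    rfl
  have k := (H (t, x) (i v) (i w)).symm.trans (H' (t, x) (i v) (i w))
  have k' := add_left_cancel k
  rw [hi, hi] at k'
  exact k'

variable [IsManifold (𝓡 3) ∞ S]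

theorem ParallelSpinorFlow.exists_adapted (F : ParallelSpinorFlow S) (o : ManifoldOrientation S) :
    ∃ e : Fin 3 → ℝ → OneFormField S, IsOrientedCoframeFamily o e ∧ IsAdapted F e := by
  have key : ∀ t x, ∃ n : TangentSpace (𝓡 3) x →L[ℝ] ℝ,
      (∀ v w, F.h t x v w = ((F.u0 t x)⁻¹ • F.u t x) v * ((F.u0 t x)⁻¹ • F.u t x) w +
        F.l t x v * F.l t x w + n v * n w) ∧
      ∀ b : Module.Basis (Fin 3) ℝ (TangentSpace (𝓡 3) x), b.orientation = o.at' x →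
        0 < (Matrix.of fun i j => (![(F.u0 t x)⁻¹ • F.u t x, F.l t x, n] i) (b j)).det := by
    intro t x
    have hne := F.u0_ne_zero t x
    have : FiniteDimensional ℝ (TangentSpace (𝓡 3) x) :=
      Module.finite_of_finrank_eq_succ (finrank_tangentSpace x)
    have hs := sharp_apply ((F.riemannian t).self_ne_zero x)
    have n1 := F.norm_u t x
    have n2 := F.norm_l t x
    have n3 := F.orthogonal t x
    simp only [formInner] at n1 n2 n3
    refine exists_oriented_third_covector (finrank_tangentSpace x) (o.at' x)
      ((F.riemannian t).symm x) ((F.riemannian t).pos x)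
      (E₀ := (F.u0 t x)⁻¹ • sharp (F.h t x) (F.u t x)) (E₁ := sharp (F.h t x) (F.l t x))
      (fun w => ?_) (fun w => hs _ w) ?_ n2 ?_
    · rw [map_smul, smul_apply, smul_apply, hs]
    · rw [map_smul, smul_apply, ← n1, smul_eq_mul, smul_eq_mul]
      field_simp
    · rw [smul_apply, n3, smul_zero]
  choose n hn hdet using key
  let e : Fin 3 → ℝ → OneFormField S := ![fun t x => (F.u0 t x)⁻¹ • F.u t x, F.l, n]
  have hmet : F.h = coframeMetric e := by
    funext t x
    ext v w
    rw [hn, coframeMetric_apply, Fin.sum_univ_three]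
    rfl
  have ho : ∀ t x (b : Module.Basis (Fin 3) ℝ (TangentSpace (𝓡 3) x)),
      b.orientation = o.at' x → 0 < (Matrix.of fun i j => e i t x (b j)).det := by
    intro t x b hb
    have := hdet t x b hb
    rw [Matrix.det_fin_three] at this ⊢
    exact this
  have s0 : SmoothOneFormFamily (e 0) := by
    refine smoothOneFormFamily_iff.2 fun p₀ a => ?_
    exact ((F.smooth_u0 p₀).inv₀ (F.u0_ne_zero _ _)).mul
      (smoothOneFormFamily_iff.1 F.smooth_u p₀ a)
  have s1 : SmoothOneFormFamily (e 1) := F.smooth_l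
  refine ⟨e, ⟨fun i => ?_, ho⟩, fun t => congrFun hmet t, fun t x => ?_, fun t x => rfl⟩
  · fin_cases i
    · exact s0
    · exact s1
    · exact smoothOneFormFamily_third s0 s1 (hmet ▸ F.smooth_h) ho
  · change F.u t x = F.u0 t x • (F.u0 t x)⁻¹ • F.u t x
    rw [smul_inv_smul₀ (F.u0_ne_zero t x)]

/-- The metric and the first two covectors determine `e_n ⊗ e_n`, hence `e_n` up to a factor `k`
with `k² = 1`; comparing determinants on an oriented basis gives `k > 0`. -/
theorem IsAdapted.unique {F : ParallelSpinorFlow S} {o : ManifoldOrientation S}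
    {e e' : Fin 3 → ℝ → OneFormField S} (he : IsOrientedCoframeFamily o e) (ha : IsAdapted F e)
    (he' : IsOrientedCoframeFamily o e') (ha' : IsAdapted F e') : e' = e := by
  have h0 : e' 0 = e 0 := by
    funext t x
    refine smul_right_injective _ (F.u0_ne_zero t x) ?_
    exact (ha'.u_eq t x).symm.trans (ha.u_eq t x)
  have h1 : e' 1 = e 1 := by
    funext t x
    exact (ha'.l_eq t x).symm.trans (ha.l_eq t x)
  have h2 : e' 2 = e 2 := by
    funext t x
    have hprod : ∀ v w, e' 2 t x v * e' 2 t x w = e 2 t x v * e 2 t x w := by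
      intro v w
      have k := coframeMetric_apply e' t x v w
      rw [← ha'.metric, ha.metric, coframeMetric_apply] at k
      simp only [Fin.sum_univ_three, h0, h1] at k
      linarith
    obtain ⟨E, hE⟩ := he.exists_dual t x
    have hEE : e 2 t x (E 2) = 1 := by simp [hE]
    set k := e' 2 t x (E 2) with hk
    have hk2 : k * k = 1 := by rw [hk, hprod, hEE, one_mul]
    have hlin : ∀ v, e' 2 t x v = k * e 2 t x v := by
      intro v
      have := hprod v (E 2)
      rw [hEE, mul_one, ← hk] at this
      calc e' 2 t x v = k * (e' 2 t x v * k) := by linear_combination -(e' 2 t x v) * hk2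
        _ = k * e 2 t x v := by rw [this]
    obtain ⟨b, hb⟩ := exists_oriented_basis o x
    have d := he.oriented t x b hb
    have d' := he'.oriented t x b hb
    have hdd : (Matrix.of fun i j => e' i t x (b j)).det =
        k * (Matrix.of fun i j => e i t x (b j)).det := by
      simp only [Matrix.det_fin_three, Matrix.of_apply, h0, h1, hlin]
      ring
    rw [hdd] at d'
    have hkpos : 0 < k := (pos_iff_pos_of_mul_pos d').2 d
    have hk1 : k = 1 := by nlinarith
    ext v
    rw [hlin, hk1, one_mul]
  funext i
  fin_cases i
  · exact h0
  · exact h1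
  · exact h2

end AdaptedCoframes

end ComovingSpinor

end

theorem mainTheorem4 {S : Type*} [TopologicalSpace S] [T2Space S] [SecondCountableTopology S]
    [ChartedSpace ComovingSpinor.E3 S] [IsManifold (𝓡 3) ∞ S]
    (o : ComovingSpinor.ManifoldOrientation S) :
    -- the existence statement, for every metric `g` on `ℝ × S`
    (∀ g : ComovingSpinor.SpacetimeBilinField S,
      ComovingSpinor.AdmitsComovingParallelSpinorFlow g ↔
        ∃ e : Fin 3 → ℝ → ComovingSpinor.OneFormField S,
          ComovingSpinor.IsOrientedCoframeFamily o e ∧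
          ComovingSpinor.ComovingFlowEquations e ∧
          ComovingSpinor.IsStandardMetric g (fun _ _ => 1) (ComovingSpinor.coframeMetric e)) ∧
    -- the same with complete metrics `h_t`
    (∀ g : ComovingSpinor.SpacetimeBilinField S,
      (ComovingSpinor.AdmitsComovingParallelSpinorFlow g ∧
          ComovingSpinor.IsComovingGloballyHyperbolic g) ↔
        ∃ e : Fin 3 → ℝ → ComovingSpinor.OneFormField S,
          ComovingSpinor.IsOrientedCoframeFamily o e ∧
          ComovingSpinor.ComovingFlowEquations e ∧
          (∀ t, ComovingSpinor.IsCompleteMetric (ComovingSpinor.coframeMetric e t)) ∧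
          ComovingSpinor.IsStandardMetric g (fun _ _ => 1) (ComovingSpinor.coframeMetric e)) ∧
    -- a comoving flow determines its family of coframes, which solves the equations
    (∀ F : ComovingSpinor.ParallelSpinorFlow S, F.IsComoving →
      (∃! e : Fin 3 → ℝ → ComovingSpinor.OneFormField S,
        ComovingSpinor.IsOrientedCoframeFamily o e ∧ ComovingSpinor.IsAdapted F e) ∧
      ∀ e : Fin 3 → ℝ → ComovingSpinor.OneFormField S,
        ComovingSpinor.IsOrientedCoframeFamily o e → ComovingSpinor.IsAdapted F e →
          ComovingSpinor.ComovingFlowEquations e) ∧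
    -- every solution comes from a comoving flow
    (∀ e : Fin 3 → ℝ → ComovingSpinor.OneFormField S,
      ComovingSpinor.IsOrientedCoframeFamily o e → ComovingSpinor.ComovingFlowEquations e →
        ∃ F : ComovingSpinor.ParallelSpinorFlow S,
          F.IsComoving ∧ ComovingSpinor.IsAdapted F e) := by
  have existence : ∀ g : ComovingSpinor.SpacetimeBilinField S,
      ComovingSpinor.AdmitsComovingParallelSpinorFlow g ↔
        ∃ e : Fin 3 → ℝ → ComovingSpinor.OneFormField S,
          ComovingSpinor.IsOrientedCoframeFamily o e ∧
          ComovingSpinor.ComovingFlowEquations e ∧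
          ComovingSpinor.IsStandardMetric g (fun _ _ => 1) (ComovingSpinor.coframeMetric e) := by
    intro g
    constructor
    · rintro ⟨F, hF, hg⟩
      obtain ⟨e, he, ha⟩ := F.exists_adapted o
      have hlapse : F.lapse = fun _ _ => 1 := by funext t x; exact hF t x
      have hh : F.h = ComovingSpinor.coframeMetric e := funext ha.metric
      exact ⟨e, he, ha.comovingFlowEquations hF he, hlapse ▸ hh ▸ hg⟩
    · rintro ⟨e, he, hc, hg⟩
      obtain ⟨F, hF, ha⟩ := hc.exists_flow he
      have hlapse : F.lapse = fun _ _ => 1 := by funext t x; exact hF t x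
      have hh : F.h = ComovingSpinor.coframeMetric e := funext ha.metric
      exact ⟨F, hF, by rw [hlapse, hh]; exact hg⟩
  refine ⟨existence, fun g => ⟨?_, ?_⟩, fun F hF => ⟨?_, ?_⟩, ?_⟩
  · rintro ⟨hg, h, -, -, hcomplete, hstd⟩
    obtain ⟨e, he, hc, hg⟩ := (existence g).1 hg
    -- The complete metrics come from a decomposition of `g` chosen independently of the flow;
    -- uniqueness identifies them with the coframe metrics.
    exact ⟨e, he, hc, hstd.unique hg ▸ hcomplete, hg⟩
  · rintro ⟨e, he, hc, hcomplete, hg⟩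
    exact ⟨(existence g).2 ⟨e, he, hc, hg⟩, ComovingSpinor.coframeMetric e, he.smoothBilinFamily,
      he.isRiemannian, hcomplete, hg⟩
  · obtain ⟨e, he, ha⟩ := F.exists_adapted o
    exact ⟨e, ⟨he, ha⟩, fun e' h' => ha.unique he h'.1 h'.2⟩
  · exact fun e he ha => ha.comovingFlowEquations hF he
  · exact fun e he hc => hc.exists_flow he
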